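/- All graphs are finite, simple and undirected. For graphs $H,G$ let $\hom(H,G)$ denote the number of homomorphisms from $H$ to $G$, i.e. of maps $V(H)\to V(G)$ that send adjacent vertices to adjacent vertices. Let $P_n$ and $S_n$ denote the path and the star on $n$ vertices. Let $T$ be a tree and let $x\neq y$ be two vertices of $T$ such that every interior vertex of the unique $x$–$y$ path in $T$ has degree two in $T$; let $z$ be the neighbor of $y$ on this path, and let $N(y)$ be the set of neighbors of $y$ in $T$. The KC-transformation of $T$ with respect to this path is the graph obtained from $T$ by deleting all edges between $y$ and $N(y)\setminus\{z\}$ and adding instead all edges between $x$ and $N(y)\setminus\{z\}$. **Theorem.** Let $m,n\ge 1$ be integers, let $T_m$ be a tree on $m$ vertices. (i) If $T'_m$ is obtained from $T_m$ by a KC-transformation, and if $n$ is even, or $n$ is odd and $\operatorname{diam}(T_m)\le n-1$, then $$\hom(T_m,P_n)\le \hom(T'_m,P_n).$$ (ii) Without any restriction on $m$ and $n$, $$\hom(P_m,P_n)\le \hom(T_m,P_n)\le \hom(S_m,P_n).$$ -/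

import Mathlib

namespace SimpleGraph

/-- The number `hom(H, G)` of graph homomorphisms from `H` to `G`. -/
noncomputable def homCount {V W : Type*} (H : SimpleGraph V) (G : SimpleGraph W) : ℕ :=
  Nat.card (H →g G)

/-- Delete all edges between `y` and `N(y) \ {z}`, and join `x` to every vertex of
`N(y) \ {z}` instead. -/
def moveNeighbors {V : Type*} (T : SimpleGraph V) (x y z : V) : SimpleGraph V :=
  T.deleteEdges {e | ∃ w ∈ T.neighborSet y \ {z}, e = s(y, w)} ⊔
    fromEdgeSet {e | ∃ w ∈ T.neighborSet y \ {z}, e = s(x, w)}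

/-- `T'` is obtained from `T` by a KC-transformation: there are two vertices `x ≠ y` and an
`x`-`y` path in `T` whose interior vertices all have degree two in `T`, such that `T'` is the
result of moving from `y` to `x` all neighbors of `y` except the neighbor of `y` on that path. -/
def IsKCTransformation {V : Type*} (T T' : SimpleGraph V) : Prop :=
  ∃ (x y : V) (p : T.Walk x y), x ≠ y ∧ p.IsPath ∧
    (∀ v ∈ p.support, v ≠ x → v ≠ y → (T.neighborSet v).ncard = 2) ∧
    T' = T.moveNeighbors x y p.penultimate

end SimpleGraph

/-! Homomorphisms into the path are maps to `{1, …, N}` whose adjacent values differ by one. With `A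
= pathOp N`, the vector of counts by root position of a tree is obtained by gluing branches: `u * A
u'`. All these vectors lie in `Cone N`: they are symmetric and increase towards the middle, within a
parity class if `N` is odd.

If a bare path of length `k` separates ends with vectors `a` and `b`, then the count is `⟨a, A^k
b⟩`, and after the KC-transformation it is `⟨a * b, A^k 1⟩`. Since `A` is symmetric and nonnegative,
the inequality between them is Chebyshev's, provided `a` and `b` are similarly ordered on all pairs
joined by a walk of length `k`. The cone supplies this if `N` or `k` is even. For odd `N` the
diameter bound leaves room to translate the branches, which gives the same ordering
(`RootedVector.pairing_pow_pathOp_le`).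

The bounds in (ii) are inductions over gluing, strengthened by a weight at the root. The upper one
uses only that the two ends of the target have degree one. The lower one for even `N` replaces
branches by paths with Chebyshev. For odd `N` odd powers of `A` are unavailable, so `A²/2` is used
on each parity class of the target. The resulting bound is a sum of two values of a convex sequence,
indexed by the sizes of the bipartition classes; it is least when these are balanced, and paths
attain that value. -/

namespace PathHom

open Finset

/-! ### The transfer operator of the target path -/

/-- The adjacency operator of the path with vertex set `{1, …, N}`, acting on functions on `ℤ`. -/
noncomputable def pathOp (N : ℤ) : (ℤ → ℝ) →ₗ[ℝ] (ℤ → ℝ) where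
  toFun f i := if i ∈ Icc 1 N then ∑ j ∈ Icc 1 N, if |i - j| = 1 then f j else 0 else 0
  map_add' f g := by
    funext i
    by_cases h : i ∈ Icc 1 N
    · simp only [h, if_true, Pi.add_apply, ← sum_add_distrib]
      exact sum_congr rfl fun j _ => by split_ifs <;> simp
    · simp only [h, if_false, Pi.add_apply, add_zero]
  map_smul' c f := by
    funext i
    by_cases h : i ∈ Icc 1 N
    · simp only [h, if_true, Pi.smul_apply, smul_eq_mul, mul_sum, RingHom.id_apply]
      exact sum_congr rfl fun j _ => by split_ifs <;> simp
    · simp only [h, if_false, Pi.smul_apply, smul_zero]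

lemma pathOp_apply (N : ℤ) (f : ℤ → ℝ) (i : ℤ) : pathOp N f i =
    if i ∈ Icc 1 N then ∑ j ∈ Icc 1 N, if |i - j| = 1 then f j else 0 else 0 := rfl

/-- The bilinear pairing of functions over `{1, …, N}`. -/
noncomputable def pairing (N : ℤ) (f g : ℤ → ℝ) : ℝ := ∑ i ∈ Icc 1 N, f i * g i

/-- The indicator function of `{1, …, N}`. -/
noncomputable def one (N : ℤ) : ℤ → ℝ := fun i => if i ∈ Icc 1 N then 1 else 0

/-- `f` vanishes outside `{1, …, N}`. -/
def Supported (N : ℤ) (f : ℤ → ℝ) : Prop := ∀ i, i ∉ Icc 1 N → f i = 0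

lemma supported_pathOp (N : ℤ) (f : ℤ → ℝ) : Supported N (pathOp N f) := fun i hi => by
  rw [pathOp_apply, if_neg hi]

lemma supported_one (N : ℤ) : Supported N (one N) := fun _ hi => if_neg hi

lemma Supported.mul_left {N : ℤ} {f : ℤ → ℝ} (hf : Supported N f) (g : ℤ → ℝ) :
    Supported N (f * g) := fun i hi => by simp [hf i hi]

lemma pathOp_of_mem {N : ℤ} {f : ℤ → ℝ} (hf : Supported N f) {i : ℤ} (hi : i ∈ Icc 1 N) :
    pathOp N f i = f (i - 1) + f (i + 1) := by
  rw [pathOp_apply, if_pos hi]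
  have h1 : ∀ j, (if |i - j| = 1 then f j else 0) =
      (if j = i - 1 then f j else 0) + (if j = i + 1 then f j else 0) := by
    intro j
    have : |i - j| = 1 ↔ j = i - 1 ∨ j = i + 1 := by grind
    rcases eq_or_ne j (i - 1) with h | h
    · simp [h]
      omega
    · rcases eq_or_ne j (i + 1) with h' | h'
      · have h'' : i + 1 ≠ i - 1 := by omega
        simp [h', h'']
      · simp [this, h, h']
  simp only [h1, sum_add_distrib, sum_ite_eq']
  congr 1
  · split_ifs with h
    · rfl
    · exact (hf _ h).symm
  · split_ifs with h
    · rfl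
    · exact (hf _ h).symm

lemma pairing_comm (N : ℤ) (f g : ℤ → ℝ) : pairing N f g = pairing N g f :=
  sum_congr rfl fun _ _ => mul_comm _ _

lemma pairing_add_left (N : ℤ) (f g h : ℤ → ℝ) :
    pairing N (f + g) h = pairing N f h + pairing N g h := by
  simp [pairing, add_mul, sum_add_distrib]

lemma pairing_add_right (N : ℤ) (f g h : ℤ → ℝ) :
    pairing N f (g + h) = pairing N f g + pairing N f h := by
  simp [pairing, mul_add, sum_add_distrib]

lemma pairing_smul_left (N : ℤ) (c : ℝ) (f g : ℤ → ℝ) :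
    pairing N (c • f) g = c * pairing N f g := by
  simp [pairing, mul_sum, mul_assoc]

lemma pairing_smul_right (N : ℤ) (c : ℝ) (f g : ℤ → ℝ) :
    pairing N f (c • g) = c * pairing N f g := by
  rw [pairing_comm, pairing_smul_left, pairing_comm]

lemma pairing_mul (N : ℤ) (f g h : ℤ → ℝ) : pairing N f (g * h) = pairing N (f * g) h := by
  simp [pairing, mul_assoc]

lemma pairing_congr {N : ℤ} {f g f' g' : ℤ → ℝ} (h : ∀ i ∈ Icc 1 N, f i * g i = f' i * g' i) :
    pairing N f g = pairing N f' g' := sum_congr rfl h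

lemma pairing_one (N : ℤ) (f : ℤ → ℝ) : pairing N f (one N) = ∑ i ∈ Icc 1 N, f i :=
  sum_congr rfl fun i hi => by simp [one, mem_Icc.1 hi]

lemma pairing_pathOp (N : ℤ) (f g : ℤ → ℝ) :
    pairing N f (pathOp N g) = pairing N (pathOp N f) g := by
  have h1 : pairing N f (pathOp N g) =
      ∑ i ∈ Icc 1 N, ∑ j ∈ Icc 1 N, if |i - j| = 1 then f i * g j else 0 :=
    sum_congr rfl fun i hi => by
      rw [pathOp_apply, if_pos hi, mul_sum]
      exact sum_congr rfl fun j _ => by split_ifs <;> simp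
  have h2 : pairing N (pathOp N f) g =
      ∑ j ∈ Icc 1 N, ∑ i ∈ Icc 1 N, if |i - j| = 1 then f i * g j else 0 :=
    sum_congr rfl fun j hj => by
      rw [pathOp_apply, if_pos hj, sum_mul]
      exact sum_congr rfl fun i _ => by rw [abs_sub_comm]; split_ifs <;> simp
  rw [h1, h2, sum_comm]

lemma pairing_pathOp_pow (N : ℤ) (k : ℕ) (f g : ℤ → ℝ) :
    pairing N f ((pathOp N ^ k) g) = pairing N ((pathOp N ^ k) f) g := by
  induction k generalizing f g with
  | zero => simp
  | succ k ih =>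
    have h1 : (pathOp N ^ (k + 1)) g = pathOp N ((pathOp N ^ k) g) := by
      rw [pow_succ']; rfl
    have h2 : (pathOp N ^ (k + 1)) f = (pathOp N ^ k) (pathOp N f) := by
      rw [pow_succ]; rfl
    rw [h1, h2, pairing_pathOp, ih]

lemma pow_pathOp_succ (N : ℤ) (k : ℕ) (f : ℤ → ℝ) :
    (pathOp N ^ (k + 1)) f = pathOp N ((pathOp N ^ k) f) := by rw [pow_succ']; rfl

lemma pow_pathOp_succ' (N : ℤ) (k : ℕ) (f : ℤ → ℝ) :
    (pathOp N ^ (k + 1)) f = (pathOp N ^ k) (pathOp N f) := by rw [pow_succ]; rfl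

lemma pow_pathOp_add (N : ℤ) (k l : ℕ) (f : ℤ → ℝ) :
    (pathOp N ^ (k + l)) f = (pathOp N ^ k) ((pathOp N ^ l) f) := by rw [pow_add]; rfl

lemma pairing_single_left {N i : ℤ} (hi : i ∈ Icc 1 N) (f : ℤ → ℝ) :
    pairing N (Pi.single i 1) f = f i := by
  simp only [pairing, Pi.single_apply, ite_mul, one_mul, zero_mul, sum_ite_eq', hi, if_true]

/-- The number of walks of length `k` from `j` to `i`, as a matrix entry. -/
noncomputable def walkEntry (N : ℤ) (k : ℕ) (i j : ℤ) : ℝ := (pathOp N ^ k) (Pi.single j 1) i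

lemma walkEntry_comm {N : ℤ} (k : ℕ) {i j : ℤ} (hi : i ∈ Icc 1 N) (hj : j ∈ Icc 1 N) :
    walkEntry N k i j = walkEntry N k j i := by
  unfold walkEntry
  rw [← pairing_single_left hi ((pathOp N ^ k) (Pi.single j 1)), pairing_pathOp_pow, pairing_comm,
    pairing_single_left hj]

lemma pow_pathOp_eq_sum {N : ℤ} (k : ℕ) (f : ℤ → ℝ) {i : ℤ} (hi : i ∈ Icc 1 N) :
    (pathOp N ^ k) f i = ∑ j ∈ Icc 1 N, walkEntry N k i j * f j := by
  rw [← pairing_single_left hi ((pathOp N ^ k) f), pairing_pathOp_pow]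
  exact sum_congr rfl fun j hj => by rw [walkEntry_comm k hi hj]; rfl

lemma pathOp_nonneg {N : ℤ} {f : ℤ → ℝ} (hf : ∀ i, 0 ≤ f i) (i : ℤ) : 0 ≤ pathOp N f i := by
  rw [pathOp_apply]
  split_ifs
  · exact sum_nonneg fun j _ => by split_ifs <;> simp [hf]
  · rfl

lemma pow_pathOp_nonneg {N : ℤ} (k : ℕ) {f : ℤ → ℝ} (hf : ∀ i, 0 ≤ f i) (i : ℤ) :
    0 ≤ (pathOp N ^ k) f i := by
  induction k generalizing i with
  | zero => simpa using hf i
  | succ k ih => rw [pow_pathOp_succ]; exact pathOp_nonneg ih i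

lemma walkEntry_nonneg (N : ℤ) (k : ℕ) (i j : ℤ) : 0 ≤ walkEntry N k i j :=
  pow_pathOp_nonneg k (fun l => by rw [Pi.single_apply]; split_ifs <;> simp) i

/-- Each step changes the position by one; hence Chebyshev's inequality only has to compare
positions at distance at most `k` and of the parity of `k`. -/
lemma walkEntry_ne_zero {N : ℤ} {k : ℕ} {i j : ℤ} (h : walkEntry N k i j ≠ 0) :
    |i - j| ≤ k ∧ (2 : ℤ) ∣ i - j - k := by
  induction k generalizing i with
  | zero =>
    have : i = j := by
      by_contra hij
      exact h (by simp [walkEntry, hij])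
    subst this; simp
  | succ k ih =>
    unfold walkEntry at h
    rw [pow_pathOp_succ, pathOp_apply] at h
    split_ifs at h with hi
    · obtain ⟨l, _, hl⟩ := exists_ne_zero_of_sum_ne_zero h
      split_ifs at hl with hil
      · have := ih hl
        push_cast
        constructor
        · grind
        · have h1 : i - l = 1 ∨ i - l = -1 := by grind
          omega
      · exact absurd rfl hl
    · exact absurd rfl h

/-! ### Chebyshev's inequality -/

/-- A Chebyshev-type inequality for the powers of the adjacency operator of a path. -/
lemma pairing_pow_pathOp_le {N : ℤ} (k : ℕ) {a b : ℤ → ℝ}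
    (h : ∀ i ∈ Icc 1 N, ∀ j ∈ Icc 1 N, |i - j| ≤ k → (2 : ℤ) ∣ i - j - k →
      0 ≤ (a i - a j) * (b i - b j)) :
    pairing N a ((pathOp N ^ k) b) ≤ pairing N (a * b) ((pathOp N ^ k) (one N)) := by
  have h1 : pairing N a ((pathOp N ^ k) b) =
      ∑ i ∈ Icc 1 N, ∑ j ∈ Icc 1 N, walkEntry N k i j * (a i * b j) :=
    sum_congr rfl fun i hi => by
      rw [pow_pathOp_eq_sum k b hi, mul_sum]
      exact sum_congr rfl fun j _ => by ring
  have h1' : pairing N a ((pathOp N ^ k) b) =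
      ∑ i ∈ Icc 1 N, ∑ j ∈ Icc 1 N, walkEntry N k i j * (a j * b i) := by
    rw [h1, sum_comm]
    exact sum_congr rfl fun i hi => sum_congr rfl fun j hj => by rw [walkEntry_comm k hi hj]
  have h2 : pairing N (a * b) ((pathOp N ^ k) (one N)) =
      ∑ i ∈ Icc 1 N, ∑ j ∈ Icc 1 N, walkEntry N k i j * (a i * b i) :=
    sum_congr rfl fun i hi => by
      rw [pow_pathOp_eq_sum k _ hi, mul_sum]
      exact sum_congr rfl fun j hj => by simp only [Pi.mul_apply, one, hj, if_true]; ring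
  have h2' : pairing N (a * b) ((pathOp N ^ k) (one N)) =
      ∑ i ∈ Icc 1 N, ∑ j ∈ Icc 1 N, walkEntry N k i j * (a j * b j) := by
    rw [h2, sum_comm]
    exact sum_congr rfl fun i hi => sum_congr rfl fun j hj => by rw [walkEntry_comm k hi hj]
  -- Symmetrisation: this sum is twice the difference of the two sides.
  have h3 : 0 ≤ ∑ i ∈ Icc 1 N, ∑ j ∈ Icc 1 N,
      walkEntry N k i j * ((a i - a j) * (b i - b j)) := by
    refine sum_nonneg fun i hi => sum_nonneg fun j hj => ?_
    by_cases hW : walkEntry N k i j = 0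
    · simp [hW]
    · obtain ⟨h4, h5⟩ := walkEntry_ne_zero hW
      exact mul_nonneg (walkEntry_nonneg N k i j) (h i hi j hj h4 h5)
  have h4 : ∑ i ∈ Icc 1 N, ∑ j ∈ Icc 1 N,
      walkEntry N k i j * ((a i - a j) * (b i - b j)) =
      pairing N (a * b) ((pathOp N ^ k) (one N)) + pairing N (a * b) ((pathOp N ^ k) (one N))
      - pairing N a ((pathOp N ^ k) b) - pairing N a ((pathOp N ^ k) b) := by
    nth_rw 1 [h2]
    nth_rw 1 [h2']
    nth_rw 1 [h1]
    rw [h1']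
    simp only [← sum_add_distrib, ← sum_sub_distrib]
    exact sum_congr rfl fun i _ => sum_congr rfl fun j _ => by ring
  linarith

/-! ### The cone of symmetric functions increasing towards the middle -/

/-- Nonnegative symmetric functions on `{1, …, N}` that increase towards the middle; if `N` is odd,
only positions of the same parity are compared. -/
structure Cone (N : ℤ) (a : ℤ → ℝ) : Prop where
  supported : Supported N a
  nonneg : ∀ i, 0 ≤ a i
  symm : ∀ i, a (N + 1 - i) = a i
  mono : ∀ i j, i ≤ j → i + j ≤ N + 1 → ((2 : ℤ) ∣ j - i ∨ (2 : ℤ) ∣ N) → a i ≤ a j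

lemma Cone.one (N : ℤ) : Cone N (one N) where
  supported := supported_one N
  nonneg i := by unfold PathHom.one; split_ifs <;> simp
  symm i := by
    have : N + 1 - i ∈ Icc 1 N ↔ i ∈ Icc 1 N := by simp only [mem_Icc]; omega
    simp only [PathHom.one, this]
  mono i j h1 h2 _ := by
    have : i ∈ Icc 1 N → j ∈ Icc 1 N := by simp only [mem_Icc]; omega
    unfold PathHom.one
    split_ifs <;> simp_all

lemma Cone.mul {N : ℤ} {a b : ℤ → ℝ} (ha : Cone N a) (hb : Cone N b) : Cone N (a * b) where
  supported := ha.supported.mul_left b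
  nonneg i := mul_nonneg (ha.nonneg i) (hb.nonneg i)
  symm i := by simp only [Pi.mul_apply, ha.symm, hb.symm]
  mono i j h1 h2 h3 := mul_le_mul (ha.mono i j h1 h2 h3) (hb.mono i j h1 h2 h3) (hb.nonneg i)
    (ha.nonneg j)

lemma Cone.smul {N : ℤ} {a : ℤ → ℝ} (ha : Cone N a) {c : ℝ} (hc : 0 ≤ c) : Cone N (c • a) where
  supported i hi := by simp [ha.supported i hi]
  nonneg i := mul_nonneg hc (ha.nonneg i)
  symm i := by simp only [Pi.smul_apply, ha.symm]
  mono i j h1 h2 h3 := mul_le_mul_of_nonneg_left (ha.mono i j h1 h2 h3) hc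

lemma Cone.pathOp {N : ℤ} {a : ℤ → ℝ} (ha : Cone N a) : Cone N (pathOp N a) where
  supported := supported_pathOp N a
  nonneg := pathOp_nonneg ha.nonneg
  symm i := by
    by_cases hi : i ∈ Icc 1 N
    · have hi' : N + 1 - i ∈ Icc 1 N := by simp only [mem_Icc] at *; omega
      rw [pathOp_of_mem ha.supported hi, pathOp_of_mem ha.supported hi', ← ha.symm (i - 1),
        ← ha.symm (i + 1), add_comm]
      congr 2 <;> ring
    · have hi' : N + 1 - i ∉ Icc 1 N := by simp only [mem_Icc] at *; omega
      rw [supported_pathOp N a _ hi, supported_pathOp N a _ hi']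
  mono i j h1 h2 h3 := by
    by_cases hi : i ∈ Icc 1 N
    · have hj : j ∈ Icc 1 N := by simp only [mem_Icc] at *; omega
      rw [pathOp_of_mem ha.supported hi, pathOp_of_mem ha.supported hj]
      rcases eq_or_lt_of_le h1 with rfl | hlt
      · rfl
      -- Away from the middle, corresponding neighbours are compared.
      by_cases h4 : i + j + 2 ≤ N + 1
      · exact add_le_add (ha.mono _ _ (by omega) (by omega) (by omega))
          (ha.mono _ _ (by omega) (by omega) (by omega))
      by_cases h5 : i + j = N + 1
      · rw [← ha.symm (i - 1), ← ha.symm (i + 1), add_comm]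
        apply le_of_eq
        congr 2 <;> linarith
      -- Here `i + j = N`, so `j - i` is even under either alternative of `h3` and at least two. The
      -- neighbours are compared crosswise, since `(i + 1) + (j + 1)` would exceed `N + 1`.
      · rw [add_comm (a (j - 1))]
        exact add_le_add (ha.mono _ _ (by omega) (by omega) (by omega))
          (ha.mono _ _ (by omega) (by omega) (by omega))
    · rw [supported_pathOp N a _ hi]
      exact pathOp_nonneg ha.nonneg j

lemma Cone.pow_pathOp {N : ℤ} {a : ℤ → ℝ} (ha : Cone N a) (k : ℕ) :
    Cone N ((PathHom.pathOp N ^ k) a) := by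
  induction k with
  | zero => simpa using ha
  | succ k ih => rw [pow_pathOp_succ]; exact ih.pathOp

lemma Cone.similarly_ordered {N : ℤ} {a b : ℤ → ℝ} (ha : Cone N a) (hb : Cone N b) {i j : ℤ}
    (h : (2 : ℤ) ∣ i - j ∨ (2 : ℤ) ∣ N) : 0 ≤ (a i - a j) * (b i - b j) := by
  wlog hij : i ≤ j generalizing i j
  · have := this (i := j) (j := i) (by omega) (by omega)
    linarith
  by_cases h2 : i + j ≤ N + 1
  · have h3 := ha.mono i j hij h2 (by omega)
    have h4 := hb.mono i j hij h2 (by omega)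
    nlinarith
  -- Past the middle the pair is reflected, which reverses both orders at once.
  · have h3 := ha.mono (N + 1 - j) (N + 1 - i) (by omega) (by omega) (by omega)
    have h4 := hb.mono (N + 1 - j) (N + 1 - i) (by omega) (by omega) (by omega)
    rw [ha.symm, ha.symm] at h3
    rw [hb.symm, hb.symm] at h4
    nlinarith

lemma Cone.pairing_pow_pathOp_le {N : ℤ} {a b : ℤ → ℝ} (ha : Cone N a) (hb : Cone N b) (k : ℕ)
    (h : Even k ∨ (2 : ℤ) ∣ N) :
    pairing N a ((PathHom.pathOp N ^ k) b) ≤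
      pairing N (a * b) ((PathHom.pathOp N ^ k) (PathHom.one N)) := by
  refine PathHom.pairing_pow_pathOp_le k fun i _ j _ _ h2 => ha.similarly_ordered hb ?_
  rcases h with ⟨l, hl⟩ | h
  · left; omega
  · exact Or.inr h

/-! ### Vectors of rooted trees and their translations -/

/-- `RootedVector N p q t u`: `u i` is the number of homomorphisms into the path on `{1, …, N}` that
send the root to `i`, for some rooted tree of height `t` with `p` vertices at even and `q` vertices
at odd distance from the root. -/
inductive RootedVector (N : ℤ) : ℕ → ℕ → ℕ → (ℤ → ℝ) → Prop
  | single : RootedVector N 1 0 0 (one N)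
  | glue {p q t p' q' t' : ℕ} {u u' : ℤ → ℝ} : RootedVector N p q t u →
      RootedVector N p' q' t' u' →
      RootedVector N (p + q') (q + p') (max t (t' + 1)) (u * pathOp N u')

namespace RootedVector

variable {N : ℤ} {p q t : ℕ} {u : ℤ → ℝ}

lemma cone (h : RootedVector N p q t u) : Cone N u := by
  induction h with
  | single => exact Cone.one N
  | glue _ _ ih ih' => exact ih.mul ih'.pathOp

lemma pos (h : RootedVector N p q t u) : 0 < p := by
  induction h with
  | single => exact one_pos
  | glue _ _ ih _ => omega

/-- A tree of height `t` rooted at `j` stays below `j + t ≤ N`, so shifting to the right by `j - i`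
embeds the homomorphisms rooted at `i` into those rooted at `j`, with no parity condition. -/
lemma le_of_translate (h : RootedVector N p q t u) {i j : ℤ} (hij : i ≤ j) (hj : j + t ≤ N) :
    u i ≤ u j := by
  induction h generalizing i j with
  | single =>
    unfold one
    split_ifs with h1 h2 <;> simp_all
    omega
  | @glue p q t p' q' t' u u' h1 h2 ih ih' =>
    push_cast at hj
    have h4 := le_max_left (t : ℤ) (t' + 1)
    have h5 := le_max_right (t : ℤ) (t' + 1)
    refine mul_le_mul (ih hij (by omega)) ?_ (h2.cone.pathOp.nonneg i) (h1.cone.nonneg j)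
    by_cases hi : i ∈ Icc 1 N
    · have hj : j ∈ Icc 1 N := by simp only [mem_Icc] at *; omega
      rw [pathOp_of_mem h2.cone.supported hi, pathOp_of_mem h2.cone.supported hj]
      exact add_le_add (ih' (by omega) (by omega)) (ih' (by omega) (by omega))
    · rw [supported_pathOp N u' _ hi]
      exact h2.cone.pathOp.nonneg j

lemma le_of_translate' (h : RootedVector N p q t u) {i j : ℤ} (hij : i ≤ j) (hi : 1 ≤ i - t) :
    u j ≤ u i := by
  rw [← h.cone.symm i, ← h.cone.symm j]
  exact h.le_of_translate (by omega) (by omega)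

/-- If the two heights together with `k` leave room for translations, then no parity assumption is
needed in Chebyshev's inequality. -/
lemma pairing_pow_pathOp_le {p' q' s : ℕ} {v : ℤ → ℝ} (hu : RootedVector N p q t u)
    (hv : RootedVector N p' q' s v) (k : ℕ) (h : (t : ℤ) + k + s + 1 ≤ N) :
    pairing N u ((pathOp N ^ k) v) ≤ pairing N (u * v) ((pathOp N ^ k) (one N)) := by
  refine PathHom.pairing_pow_pathOp_le k fun i _ j _ h1 _ => ?_
  clear * - hu hv h h1
  wlog hst : s ≤ t generalizing u v s t p q p' q'
  · have := this hv hu (by omega) (by omega)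
    linarith
  wlog hij : i ≤ j generalizing i j
  · have := this (i := j) (j := i) (by rwa [abs_sub_comm]) (by omega)
    linarith
  have h2 : j - i ≤ k := by rw [abs_sub_comm] at h1; exact (abs_le.1 h1).2
  -- Near the left end both vectors increase, in the middle the shorter tree has a constant vector,
  -- and near the right end both decrease. The bound `h` on `N` lets these three cases cover
  -- everything.
  by_cases h3 : i ≤ s
  · have h4 := hu.le_of_translate hij (by omega)
    have h5 := hv.le_of_translate hij (by omega)
    nlinarith
  by_cases h6 : j + s ≤ N
  · have h5 := hv.le_of_translate hij (by omega)
    have h7 := hv.le_of_translate' hij (by omega)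
    rw [le_antisymm h5 h7]; simp
  · have h4 := hu.le_of_translate' hij (by omega)
    have h5 := hv.le_of_translate' hij (by omega)
    nlinarith

end RootedVector

/-! ### The upper bound by stars -/

lemma one_le_pathOp {N : ℤ} (hN : 2 ≤ N) {f : ℤ → ℝ} (hf : Supported N f)
    (h : ∀ i ∈ Icc 1 N, 1 ≤ f i) : ∀ i ∈ Icc 1 N, 1 ≤ pathOp N f i := by
  have h0 : ∀ i, 0 ≤ f i := fun i => by
    by_cases hi : i ∈ Icc 1 N
    · linarith [h i hi]
    · rw [hf i hi]
  intro i hi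
  rw [pathOp_of_mem hf hi]
  simp only [mem_Icc] at h hi
  by_cases h1 : i = 1
  · linarith [h (i + 1) (by omega), h0 (i - 1)]
  · linarith [h (i - 1) (by omega), h0 (i + 1)]

lemma RootedVector.one_le {N : ℤ} (hN : 2 ≤ N) {p q t : ℕ} {u : ℤ → ℝ}
    (h : RootedVector N p q t u) : ∀ i ∈ Icc 1 N, 1 ≤ u i := by
  induction h with
  | single => intro i hi; simp [one, mem_Icc.1 hi]
  | glue _ h2 ih ih' =>
    exact fun i hi => one_le_mul_of_one_le_of_one_le (ih i hi)
      (one_le_pathOp hN h2.cone.supported ih' i hi)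

lemma pathOp_one_apply {N : ℤ} {i : ℤ} (hi : i ∈ Icc 1 N) :
    pathOp N (one N) i = 2 - (if i = 1 then 1 else 0) - (if i = N then 1 else 0) := by
  rw [pathOp_of_mem (supported_one N) hi]
  have h1 : one N (i - 1) = 1 - (if i = 1 then 1 else 0) := by
    simp only [one, mem_Icc] at *
    split_ifs <;> first | omega | norm_num
  have h2 : one N (i + 1) = 1 - (if i = N then 1 else 0) := by
    simp only [one, mem_Icc] at *
    split_ifs <;> first | omega | norm_num
  rw [h1, h2]; ring

lemma pairing_pathOp_one {N : ℤ} (hN : 1 ≤ N) (f : ℤ → ℝ) :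
    pairing N f (pathOp N (one N)) = 2 * pairing N f (one N) - f 1 - f N := by
  have h : pairing N f (pathOp N (one N)) = ∑ i ∈ Icc 1 N,
      (2 * (f i * one N i) - (if i = 1 then f i else 0) - (if i = N then f i else 0)) :=
    sum_congr rfl fun i hi => by
      rw [pathOp_one_apply hi]
      simp only [one, hi, if_true]
      split_ifs <;> ring
  rw [h, sum_sub_distrib, sum_sub_distrib, sum_ite_eq', sum_ite_eq', ← mul_sum,
    if_pos (by simpa using hN), if_pos (by simpa using hN)]
  rfl

/-- The upper bound for weighted homomorphism counts, with equality for stars. -/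
lemma RootedVector.pairing_le {N : ℤ} (hN : 2 ≤ N) {p q t : ℕ} {u : ℤ → ℝ}
    (h : RootedVector N p q t u) (a : ℤ → ℝ) (ha : ∀ i ∈ Icc 1 N, 1 ≤ a i) :
    2 * pairing N a u ≤ 2 ^ (p + q) * pairing N a (one N) - 2 * 2 ^ (p + q) + 4 := by
  induction h generalizing a with
  | single => norm_num
  | @glue p q t p' q' t' u u' h1 h2 ih ih' =>
    have hau : Supported N (a * u) := fun i hi => by simp [h1.cone.supported i hi]
    have hau1 : ∀ i ∈ Icc 1 N, 1 ≤ (a * u) i := fun i hi =>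
      one_le_mul_of_one_le_of_one_le (ha i hi) (h1.one_le hN i hi)
    -- The first tree enters the weight for the second. Moving `A` back onto `1` doubles `⟨a, u⟩`
    -- and loses its values at the ends, each at least one; this loss cancels the constant `4` of
    -- the other induction hypothesis.
    have h3 := ih' _ (one_le_pathOp hN hau hau1)
    rw [← pairing_pathOp, ← pairing_pathOp, pairing_pathOp_one (by omega), ← pairing_mul] at h3
    have h4 := ih a ha
    have h5 : pairing N (a * u) (one N) = pairing N a u :=
      pairing_congr fun i hi => by simp [one, mem_Icc.1 hi]
    have h6 := hau1 1 (by simp; omega)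
    have h7 := hau1 N (by simp; omega)
    have h8 : (2 : ℝ) ^ (p + q' + (q + p')) = 2 ^ (p + q) * 2 ^ (p' + q') := by
      rw [← pow_add]; congr 1; omega
    have h9 : (0 : ℝ) < 2 ^ (p' + q') := by positivity
    rw [h8]
    rw [h5] at h3
    nlinarith [mul_le_mul_of_nonneg_left h4 h9.le, mul_le_mul_of_nonneg_left h6 h9.le,
      mul_le_mul_of_nonneg_left h7 h9.le]

/-! ### The lower bound by paths, even target -/

/-- Among trees with a given number of vertices, paths minimise the weighted homomorphism counts,
when the target path has an even number of vertices. -/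
lemma RootedVector.le_pairing_of_even {N : ℤ} (hN : (2 : ℤ) ∣ N) {p q t : ℕ} {u : ℤ → ℝ}
    (h : RootedVector N p q t u) (a : ℤ → ℝ) (ha : Cone N a) (k : ℕ) (hk : p + q = k + 1) :
    pairing N a ((pathOp N ^ k) (one N)) ≤ pairing N a u := by
  induction h generalizing a k with
  | single =>
    obtain rfl : k = 0 := by omega
    simp
  | @glue p q t p' q' t' u u' h1 h2 ih ih' =>
    have hp := h1.pos
    have hp' := h2.pos
    obtain ⟨l, hl⟩ : ∃ l, p + q = l + 1 := ⟨p + q - 1, by omega⟩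
    obtain ⟨l', hl'⟩ : ∃ l', p' + q' = l' + 1 := ⟨p' + q' - 1, by omega⟩
    obtain rfl : k = (l' + 1) + l := by omega
    have hw : ∀ j, Cone N ((pathOp N ^ j) (one N)) := (Cone.one N).pow_pathOp
    rw [pairing_mul, pairing_pathOp]
    -- Chebyshev turns the path weighted at its end into two paths glued at the weighted vertex;
    -- each is then replaced by its tree, the other branch being part of the weight.
    calc pairing N a ((pathOp N ^ (l' + 1 + l)) (one N))
        ≤ pairing N (a * (pathOp N ^ l) (one N)) ((pathOp N ^ (l' + 1)) (one N)) := by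
          rw [pow_pathOp_add]
          exact ha.pairing_pow_pathOp_le (hw l) _ (Or.inr hN)
      _ = pairing N (a * (pathOp N ^ (l' + 1)) (one N)) ((pathOp N ^ l) (one N)) :=
          pairing_congr fun i _ => by simp only [Pi.mul_apply]; ring
      _ ≤ pairing N (a * (pathOp N ^ (l' + 1)) (one N)) u := ih _ (ha.mul (hw _)) l hl
      _ = pairing N (pathOp N (a * u)) ((pathOp N ^ l') (one N)) := by
          rw [← pairing_pathOp, ← pow_pathOp_succ]
          exact pairing_congr fun i _ => by simp only [Pi.mul_apply]; ring
      _ ≤ pairing N (pathOp N (a * u)) u' := ih' _ (ha.mul h1.cone).pathOp l' hl'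

/-! ### The lower bound by paths, odd target -/

/-- `a` vanishes at the positions that are not congruent to `ε` modulo two. -/
def ParitySupported (ε : ℤ) (a : ℤ → ℝ) : Prop := ∀ i, ¬ (2 : ℤ) ∣ i - ε → a i = 0

lemma ParitySupported.mul {ε : ℤ} {a : ℤ → ℝ} (ha : ParitySupported ε a) (b : ℤ → ℝ) :
    ParitySupported ε (a * b) := fun i hi => by simp [ha i hi]

lemma ParitySupported.pathOp {ε ε' : ℤ} {a : ℤ → ℝ} (N : ℤ) (ha : ParitySupported ε a)
    (h : ¬ (2 : ℤ) ∣ ε - ε') : ParitySupported ε' (pathOp N a) := fun i hi => by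
  rw [pathOp_apply]
  split_ifs
  · refine sum_eq_zero fun j _ => ?_
    split_ifs with hj
    · have : i - j = 1 ∨ i - j = -1 := by grind
      exact ha j (by omega)
    · rfl
  · rfl

lemma ParitySupported.pow_pathOp {ε : ℤ} {a : ℤ → ℝ} (N : ℤ) (ha : ParitySupported ε a) (k : ℕ) :
    ParitySupported ε ((PathHom.pathOp N ^ (2 * k)) a) := by
  induction k with
  | zero => simpa using ha
  | succ k ih =>
    rw [show 2 * (k + 1) = 2 * k + 1 + 1 by ring, pow_pathOp_succ, pow_pathOp_succ]
    exact (ih.pathOp N (ε' := ε + 1) (by omega)).pathOp N (by omega)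

/-- For odd `N` both ends are odd, so every even position has exactly two neighbours. -/
lemma pairing_pathOp_one_of_even_supported {N : ℤ} (hN : ¬ (2 : ℤ) ∣ N) {a : ℤ → ℝ}
    (ha : ParitySupported 0 a) :
    pairing N a (pathOp N (one N)) = 2 * pairing N a (one N) := by
  rw [← pairing_smul_right]
  refine pairing_congr fun i hi => ?_
  rw [pathOp_one_apply hi]
  by_cases h : (2 : ℤ) ∣ i - 0
  · rw [if_neg (by omega), if_neg (by omega)]
    simp [one, mem_Icc.1 hi]
  · simp [ha i h]

/-- Half of the square of the adjacency operator. -/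
noncomputable def lazyOp (N : ℤ) : (ℤ → ℝ) →ₗ[ℝ] (ℤ → ℝ) := (1 / 2 : ℝ) • pathOp N ^ 2

lemma lazyOp_pow_apply (N : ℤ) (k : ℕ) (f : ℤ → ℝ) :
    (lazyOp N ^ k) f = (1 / 2 : ℝ) ^ k • (pathOp N ^ (2 * k)) f := by
  rw [lazyOp, smul_pow, ← pow_mul]; rfl

lemma pairing_lazyOp_pow (N : ℤ) (k : ℕ) (f g : ℤ → ℝ) :
    pairing N f ((lazyOp N ^ k) g) = (1 / 2 : ℝ) ^ k * pairing N f ((pathOp N ^ (2 * k)) g) := by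
  rw [lazyOp_pow_apply, pairing_smul_right]

lemma Cone.lazyOp_pow {N : ℤ} {a : ℤ → ℝ} (ha : Cone N a) (k : ℕ) :
    Cone N ((lazyOp N ^ k) a) := by
  rw [lazyOp_pow_apply]
  exact (ha.pow_pathOp _).smul (by positivity)

lemma Cone.pairing_lazyOp_pow_le {N : ℤ} {a b : ℤ → ℝ} (ha : Cone N a) (hb : Cone N b) (k : ℕ) :
    pairing N a ((lazyOp N ^ k) b) ≤ pairing N (a * b) ((lazyOp N ^ k) (PathHom.one N)) := by
  rw [pairing_lazyOp_pow, pairing_lazyOp_pow]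
  exact mul_le_mul_of_nonneg_left
    (ha.pairing_pow_pathOp_le hb _ (Or.inl (even_two_mul k))) (by positivity)

/-- Even powers of `A` preserve parity, so they can be moved onto `a`, leaving a single step from
even positions. -/
lemma pairing_pathOp_lazyOp_pow_of_even_supported {N : ℤ} (hN : ¬ (2 : ℤ) ∣ N) {a : ℤ → ℝ}
    (ha : ParitySupported 0 a) (k : ℕ) :
    pairing N a (pathOp N ((lazyOp N ^ k) (one N))) =
      2 * pairing N a ((lazyOp N ^ k) (one N)) := by
  rw [lazyOp_pow_apply, map_smul, pairing_smul_right, pairing_smul_right, ← pow_pathOp_succ,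
    pow_pathOp_succ', pairing_pathOp_pow, pairing_pathOp_pow,
    pairing_pathOp_one_of_even_supported hN (ha.pow_pathOp N k)]
  ring

/-- A step from an odd position lands on an even one, where `A 1` is twice `1`; so an additional
step with factor `1 / 2` completes another `lazyOp`. -/
lemma pairing_pathOp_lazyOp_pow_of_odd_supported {N : ℤ} (hN : ¬ (2 : ℤ) ∣ N) {a : ℤ → ℝ}
    (ha : ParitySupported 1 a) (k : ℕ) :
    pairing N a (pathOp N ((lazyOp N ^ k) (one N))) =
      pairing N a ((lazyOp N ^ (k + 1)) (one N)) := by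
  have h := pairing_pathOp_one_of_even_supported hN
    ((ha.pathOp N (ε' := 0) (by omega)).pow_pathOp N k)
  rw [← pow_pathOp_succ', ← pairing_pathOp_pow, ← pairing_pathOp_pow, ← pow_pathOp_succ'] at h
  rw [lazyOp_pow_apply, lazyOp_pow_apply, map_smul, pairing_smul_right, pairing_smul_right,
    ← pow_pathOp_succ, show 2 * (k + 1) = 2 * k + 1 + 1 by ring, h, pow_succ]
  ring

/-- The lower bounds for the weighted homomorphism counts when the target path has an odd number of
vertices, separately for the two classes to which the root can be sent. -/
lemma RootedVector.le_pairing_of_odd {N : ℤ} (hN : ¬ (2 : ℤ) ∣ N) {p q t : ℕ} {u : ℤ → ℝ}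
    (h : RootedVector N p q t u) (a : ℤ → ℝ) (ha : Cone N a) :
    (ParitySupported 0 a →
      2 ^ q * pairing N a ((lazyOp N ^ (p - 1)) (one N)) ≤ pairing N a u) ∧
    (ParitySupported 1 a →
      2 ^ (p - 1) * pairing N a ((lazyOp N ^ q) (one N)) ≤ pairing N a u) := by
  induction h generalizing a with
  | single => simp
  | @glue p q t p' q' t' u u' h1 h2 ih ih' =>
    have hp := h1.pos
    have hp' := h2.pos
    have hw : ∀ j, Cone N ((lazyOp N ^ j) (one N)) := (Cone.one N).lazyOp_pow
    -- Chebyshev is available for odd `N` because powers of `lazyOp` are even powers of `A`.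
    have hmerge : ∀ j l, pairing N a ((lazyOp N ^ (j + l)) (one N)) ≤
        pairing N (a * (lazyOp N ^ j) (one N)) ((lazyOp N ^ l) (one N)) := fun j l => by
      rw [add_comm, pow_add]
      exact ha.pairing_lazyOp_pow_le (hw j) l
    have hswap : ∀ j, pairing N (a * (lazyOp N ^ j) (one N)) u =
        pairing N (a * u) ((lazyOp N ^ j) (one N)) := fun j =>
      pairing_congr fun i _ => by simp only [Pi.mul_apply]; ring
    rw [pairing_mul, pairing_pathOp]
    have hcone := (ha.mul h1.cone).pathOp
    constructor
    · intro hs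
      -- The child of the root is sent to the opposite parity class, so the other half of its
      -- induction hypothesis applies and `p'`, `q'` change roles.
      have h3 := (ih' _ hcone).2 ((hs.mul u).pathOp N (by omega))
      rw [← pairing_pathOp, pairing_pathOp_lazyOp_pow_of_even_supported hN (hs.mul u),
        ← hswap] at h3
      have h4 := (ih _ (ha.mul (hw q'))).1 (hs.mul _)
      have h5 := hmerge q' (p - 1)
      rw [show q' + (p - 1) = p + q' - 1 by omega] at h5
      have h6 : (2 : ℝ) ^ (q + p') = 2 ^ q * (2 ^ (p' - 1) * 2) := by
        rw [← pow_succ, ← pow_add]; congr 1; omega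
      rw [h6]
      refine le_trans ?_ h3
      have h7 : (2 : ℝ) ^ q * pairing N a ((lazyOp N ^ (p + q' - 1)) (one N)) ≤ _ :=
        (mul_le_mul_of_nonneg_left h5 (by positivity)).trans h4
      have h8 := mul_le_mul_of_nonneg_left h7 (by positivity : (0 : ℝ) ≤ 2 ^ (p' - 1) * 2)
      linarith
    · intro hs
      have h3 := (ih' _ hcone).1 ((hs.mul u).pathOp N (by omega))
      rw [← pairing_pathOp, pairing_pathOp_lazyOp_pow_of_odd_supported hN (hs.mul u),
        show p' - 1 + 1 = p' by omega, ← hswap] at h3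
      have h4 := (ih _ (ha.mul (hw p'))).2 (hs.mul _)
      have h5 := hmerge p' q
      rw [add_comm p' q] at h5
      have h6 : (2 : ℝ) ^ (p + q' - 1) = 2 ^ (p - 1) * 2 ^ q' := by
        rw [← pow_add]; congr 1; omega
      rw [h6]
      refine le_trans ?_ h3
      have h7 : (2 : ℝ) ^ (p - 1) * pairing N a ((lazyOp N ^ (q + p')) (one N)) ≤ _ :=
        (mul_le_mul_of_nonneg_left h5 (by positivity)).trans h4
      have h8 := mul_le_mul_of_nonneg_left h7 (by positivity : (0 : ℝ) ≤ 2 ^ q')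
      linarith

/-- The part of `one N` on the positions congruent to `ε` modulo two. -/
noncomputable def parityOne (N ε : ℤ) : ℤ → ℝ := fun i => if (2 : ℤ) ∣ i - ε then one N i else 0

lemma paritySupported_parityOne (N ε : ℤ) : ParitySupported ε (parityOne N ε) :=
  fun _ hi => if_neg hi

lemma parityOne_add (N : ℤ) : parityOne N 0 + parityOne N 1 = one N := by
  funext i
  simp only [parityOne, Pi.add_apply]
  by_cases h : (2 : ℤ) ∣ i - 0
  · rw [if_pos h, if_neg (by omega), add_zero]
  · rw [if_neg h, if_pos (by omega), zero_add]

/-- For odd `N` reflection preserves parity and `mono` compares only positions of equal parity. -/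
lemma Cone.parityOne {N : ℤ} (hN : ¬ (2 : ℤ) ∣ N) (ε : ℤ) : Cone N (parityOne N ε) where
  supported i hi := by simp [PathHom.parityOne, supported_one N i hi]
  nonneg i := by
    unfold PathHom.parityOne
    split_ifs
    · exact (Cone.one N).nonneg i
    · rfl
  symm i := by
    have : (2 : ℤ) ∣ N + 1 - i - ε ↔ (2 : ℤ) ∣ i - ε := by omega
    simp only [PathHom.parityOne, this, (Cone.one N).symm]
  mono i j h1 h2 h3 := by
    have : (2 : ℤ) ∣ j - ε ↔ (2 : ℤ) ∣ i - ε := by omega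
    simp only [PathHom.parityOne, this]
    split_ifs
    · exact (Cone.one N).mono i j h1 h2 h3
    · rfl

lemma pairing_eq_zero_of_parity {N ε ε' : ℤ} (h : ¬ (2 : ℤ) ∣ ε - ε') {a b : ℤ → ℝ}
    (ha : ParitySupported ε a) (hb : ParitySupported ε' b) : pairing N a b = 0 :=
  sum_eq_zero fun i _ => by
    by_cases hi : (2 : ℤ) ∣ i - ε
    · rw [hb i (by omega), mul_zero]
    · rw [ha i hi, zero_mul]

lemma pathOp_parityOne_one {N : ℤ} (hN : ¬ (2 : ℤ) ∣ N) :
    pathOp N (parityOne N 1) = (2 : ℝ) • parityOne N 0 := by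
  have hO := (Cone.parityOne hN 1).supported
  funext i
  by_cases hi : i ∈ Icc 1 N
  · rw [pathOp_of_mem hO hi]
    simp only [parityOne, one, Pi.smul_apply, mem_Icc, smul_eq_mul] at *
    by_cases h : (2 : ℤ) ∣ i - 0
    · rw [if_pos (by omega), if_pos (by omega), if_pos (by omega), if_pos (by omega), if_pos h,
        if_pos hi]
      norm_num
    · rw [if_neg (by omega), if_neg (by omega), if_neg h]
      norm_num
  · rw [supported_pathOp N _ i hi, Pi.smul_apply, (Cone.parityOne hN 0).supported i hi, smul_zero]

/-- Normalised numbers of closed-class walks of length `2 * k` that start at even positions. -/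
noncomputable def evenWalkDensity (N : ℤ) (k : ℕ) : ℝ :=
  (1 / 4) ^ k * pairing N (parityOne N 0) ((pathOp N ^ (2 * k)) (parityOne N 0))

/-- With `E` the indicator of the even positions, this is the nonnegativity of the squared norm of
`(A/2)^k E - (A/2)^(k+2) E`. -/
lemma evenWalkDensity_convex (N : ℤ) (k : ℕ) :
    2 * evenWalkDensity N (k + 1) ≤ evenWalkDensity N k + evenWalkDensity N (k + 2) := by
  unfold evenWalkDensity
  generalize parityOne N 0 = E
  set f := (1 / 2 : ℝ) ^ k • (pathOp N ^ k) E with hf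
  set g := -((1 / 2 : ℝ) ^ (k + 2) • (pathOp N ^ (k + 2)) E) with hg
  have key : ∀ i j : ℕ, pairing N ((pathOp N ^ i) E) ((pathOp N ^ j) E) =
      pairing N E ((pathOp N ^ (i + j)) E) := fun i j => by
    rw [pow_pathOp_add, pairing_pathOp_pow N i]
  have hneg : g = (-(1 / 2 : ℝ) ^ (k + 2)) • (pathOp N ^ (k + 2)) E := by rw [hg, neg_smul]
  have h0 : 0 ≤ pairing N (f + g) (f + g) := sum_nonneg fun i _ => mul_self_nonneg _
  have e4 : ∀ j : ℕ, (1 / 4 : ℝ) ^ j = (1 / 2) ^ j * (1 / 2) ^ j := fun j => by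
    rw [← mul_pow]; norm_num
  rw [pairing_add_left, pairing_add_right, pairing_add_right, hneg, hf, pairing_smul_left,
    pairing_smul_left, pairing_smul_left, pairing_smul_left, pairing_smul_right,
    pairing_smul_right, pairing_smul_right, pairing_smul_right, key, key, key, key,
    show k + k = 2 * k by ring, show k + (k + 2) = 2 * (k + 1) by ring,
    show k + 2 + k = 2 * (k + 1) by ring, show k + 2 + (k + 2) = 2 * (k + 2) by ring] at h0
  rw [e4, e4, e4]
  have e1 : (1 / 2 : ℝ) ^ (k + 1) = (1 / 2) ^ k * (1 / 2) := pow_succ _ _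
  have e2 : (1 / 2 : ℝ) ^ (k + 2) = (1 / 2) ^ k * (1 / 2) * (1 / 2) := by
    rw [pow_succ, pow_succ]
  rw [e2] at h0
  rw [e1, e2]
  linarith

/-- Increments of a convex sequence are monotone, so moving two arguments towards each other by `g`
does not increase the sum. -/
lemma convex_add_le_add {c : ℕ → ℝ} (h : ∀ k, 2 * c (k + 1) ≤ c k + c (k + 2)) (i g e : ℕ) :
    c (i + g) + c (i + g + e) ≤ c i + c (i + 2 * g + e) := by
  have hd : ∀ i j, c (i + 1) - c i ≤ c (i + j + 1) - c (i + j) := fun i j => by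
    induction j with
    | zero => simp
    | succ j ih => have := h (i + j); rw [← add_assoc]; linarith
  induction g generalizing i with
  | zero => simp
  | succ g ih =>
    have h1 := ih (i + 1)
    have h2 := hd i (2 * g + 1 + e)
    rw [show i + 1 + g = i + (g + 1) by ring,
      show i + 1 + 2 * g + e = i + (2 * g + 1 + e) by ring] at h1
    rw [show i + 2 * (g + 1) + e = i + (2 * g + 1 + e) + 1 by ring]
    linarith

lemma pairing_parityOne_zero_lazyOp_pow {N : ℤ} (k : ℕ) :
    pairing N (parityOne N 0) ((lazyOp N ^ k) (one N)) = 2 ^ k * evenWalkDensity N k := by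
  rw [pairing_lazyOp_pow, evenWalkDensity, ← parityOne_add, map_add, pairing_add_right,
    pairing_eq_zero_of_parity (ε := 0) (ε' := 1) (by omega) (paritySupported_parityOne N 0)
      ((paritySupported_parityOne N 1).pow_pathOp N k), add_zero, ← mul_assoc, ← mul_pow]
  norm_num

/-- A step from the odd class gives twice the indicator of the even one, so a single sequence
describes both classes. -/
lemma pairing_parityOne_one_lazyOp_pow {N : ℤ} (hN : ¬ (2 : ℤ) ∣ N) (k : ℕ) :
    pairing N (parityOne N 1) ((lazyOp N ^ (k + 1)) (one N)) =
      2 * (2 ^ k * evenWalkDensity N k) := by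
  rw [← pairing_pathOp_lazyOp_pow_of_odd_supported hN (paritySupported_parityOne N 1),
    pairing_pathOp, pathOp_parityOne_one hN, pairing_smul_left, pairing_parityOne_zero_lazyOp_pow]

lemma pow_pathOp_two_mul (N : ℤ) (k : ℕ) (f : ℤ → ℝ) :
    (pathOp N ^ (2 * k)) f = (2 : ℝ) ^ k • (lazyOp N ^ k) f := by
  rw [lazyOp_pow_apply, smul_smul, ← mul_pow]
  norm_num

lemma pairing_one_eq_add (N : ℤ) (f : ℤ → ℝ) :
    pairing N (one N) f = pairing N (parityOne N 0) f + pairing N (parityOne N 1) f := by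
  rw [← pairing_add_left, parityOne_add]

lemma pairing_one_pow_pathOp_even {N : ℤ} (hN : ¬ (2 : ℤ) ∣ N) (k : ℕ) :
    pairing N (one N) ((pathOp N ^ (2 * (k + 1))) (one N)) =
      2 ^ (2 * (k + 1)) * (evenWalkDensity N k + evenWalkDensity N (k + 1)) := by
  rw [pow_pathOp_two_mul, pairing_smul_right, pairing_one_eq_add,
    pairing_parityOne_zero_lazyOp_pow, pairing_parityOne_one_lazyOp_pow hN]
  ring

lemma pairing_one_pow_pathOp_odd {N : ℤ} (hN : ¬ (2 : ℤ) ∣ N) (k : ℕ) :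
    pairing N (one N) ((pathOp N ^ (2 * k + 1)) (one N)) =
      2 ^ (2 * k + 1) * (evenWalkDensity N k + evenWalkDensity N k) := by
  rw [pow_pathOp_succ, pow_pathOp_two_mul, map_smul, pairing_smul_right, pairing_one_eq_add,
    pairing_pathOp_lazyOp_pow_of_even_supported hN (paritySupported_parityOne N 0),
    pairing_pathOp_lazyOp_pow_of_odd_supported hN (paritySupported_parityOne N 1),
    pairing_parityOne_zero_lazyOp_pow, pairing_parityOne_one_lazyOp_pow hN]
  ring

lemma RootedVector.eq_single {N : ℤ} {p t : ℕ} {u : ℤ → ℝ} (h : RootedVector N p 0 t u) :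
    p = 1 ∧ u = one N := by
  generalize hq : 0 = q at h
  cases h with
  | single => simp
  | glue _ h2 => have := h2.pos; omega

/-- Among trees with a given number of vertices, paths minimise the number of homomorphisms. -/
theorem RootedVector.le_pairing_one {N : ℤ} {p q t : ℕ} {u : ℤ → ℝ}
    (h : RootedVector N p q t u) (k : ℕ) (hk : p + q = k + 1) :
    pairing N (one N) ((pathOp N ^ k) (one N)) ≤ pairing N (one N) u := by
  by_cases hN : (2 : ℤ) ∣ N
  · exact h.le_pairing_of_even hN _ (Cone.one N) k hk
  obtain ⟨p, rfl⟩ : ∃ p', p = p' + 1 := ⟨p - 1, by have := h.pos; omega⟩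
  -- The density for the odd class has index `q - 1`, so `q = 0`, the single vertex, is separate.
  rcases q with _ | q
  · obtain ⟨h1, rfl⟩ := h.eq_single
    obtain rfl : k = 0 := by omega
    simp
  have h1 := (h.le_pairing_of_odd hN _ (Cone.parityOne hN 0)).1 (paritySupported_parityOne N 0)
  have h2 := (h.le_pairing_of_odd hN _ (Cone.parityOne hN 1)).2 (paritySupported_parityOne N 1)
  rw [Nat.add_sub_cancel, pairing_parityOne_zero_lazyOp_pow] at h1
  rw [Nat.add_sub_cancel, pairing_parityOne_one_lazyOp_pow hN] at h2
  have h3 : 2 ^ k * (evenWalkDensity N p + evenWalkDensity N q) ≤ pairing N (one N) u := by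
    rw [pairing_one_eq_add]
    obtain rfl : k = p + (q + 1) := by omega
    have e1 : (2 : ℝ) ^ (p + (q + 1)) = 2 ^ p * 2 ^ q * 2 := by ring
    have e2 : (2 : ℝ) ^ (q + 1) = 2 ^ q * 2 := by ring
    rw [e1]
    rw [e2] at h1
    linarith
  refine le_trans ?_ h3
  have hc := convex_add_le_add (evenWalkDensity_convex N)
  -- Here `e` is the parity of `i + j`, and `l`, `l + e` is its balanced splitting.
  have hbal : ∀ i j l e, i ≤ j → i + j = 2 * l + e → e ≤ 1 →
      evenWalkDensity N l + evenWalkDensity N (l + e) ≤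
        evenWalkDensity N i + evenWalkDensity N j := fun i j l e h4 h5 h6 => by
    have := hc i (l - i) e
    rwa [show i + (l - i) = l by omega, show i + 2 * (l - i) + e = j by omega] at this
  have hbal' : ∀ l e, p + q = 2 * l + e → e ≤ 1 →
      evenWalkDensity N l + evenWalkDensity N (l + e) ≤
        evenWalkDensity N p + evenWalkDensity N q := fun l e h5 h6 => by
    rcases le_total p q with h7 | h7
    · exact hbal p q l e h7 h5 h6
    · rw [add_comm (evenWalkDensity N p)]
      exact hbal q p l e h7 (by omega) h6
  rcases Nat.even_or_odd' (p + q) with ⟨l, hl | hl⟩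
  · obtain rfl : k = 2 * l + 1 := by omega
    rw [pairing_one_pow_pathOp_odd hN]
    exact mul_le_mul_of_nonneg_left (hbal' l 0 hl (by omega)) (by positivity)
  · obtain rfl : k = 2 * (l + 1) := by omega
    rw [pairing_one_pow_pathOp_even hN]
    exact mul_le_mul_of_nonneg_left (hbal' l 1 hl le_rfl) (by positivity)

/-! ### Homomorphisms as integer-valued functions and gluing along an edge -/

open scoped Classical in
/-- The homomorphisms from `T` to the path with vertex set `{1, …, N}`, as integer-valued
functions. -/
noncomputable def homs {V : Type*} [Finite V] (T : SimpleGraph V) (N : ℤ) : Finset (V → ℤ) :=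
  haveI := Fintype.ofFinite V
  (Fintype.piFinset fun _ => Icc 1 N).filter fun f => ∀ v w, T.Adj v w → |f v - f w| = 1

section

variable {V : Type*} [Finite V] {T : SimpleGraph V} {N : ℤ}

lemma mem_homs {f : V → ℤ} :
    f ∈ homs T N ↔ (∀ v, f v ∈ Icc 1 N) ∧ ∀ v w, T.Adj v w → |f v - f w| = 1 := by
  simp [homs, Fintype.mem_piFinset]

lemma homCount_pathGraph (n : ℕ) :
    T.homCount (SimpleGraph.pathGraph n) = (homs T (n : ℤ)).card := by
  have hcard : Nat.card (homs T (n : ℤ) : Set (V → ℤ)) = (homs T (n : ℤ)).card := by simp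
  rw [SimpleGraph.homCount, ← hcard]
  refine Nat.card_congr
    { toFun := fun f => ⟨fun v => (f v : ℕ) + 1, ?_⟩
      invFun := fun f => ⟨fun v => ⟨(f.1 v - 1).toNat, ?_⟩, ?_⟩
      left_inv := ?_
      right_inv := ?_ }
  · rw [mem_coe, mem_homs]
    refine ⟨fun v => ?_, fun v w h => ?_⟩
    · have := (f v).2
      rw [mem_Icc]; omega
    · have := SimpleGraph.pathGraph_adj.1 (f.map_adj h)
      rw [abs_eq one_pos.le]; omega
  · have := mem_Icc.1 ((mem_homs.1 (mem_coe.1 f.2)).1 v)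
    omega
  · intro v w h
    have h1 := (mem_homs.1 (mem_coe.1 f.2)).2 v w h
    have h2 := mem_Icc.1 ((mem_homs.1 (mem_coe.1 f.2)).1 v)
    have h3 := mem_Icc.1 ((mem_homs.1 (mem_coe.1 f.2)).1 w)
    rw [abs_eq one_pos.le] at h1
    rw [SimpleGraph.pathGraph_adj]
    simp only
    omega
  · intro f
    ext v
    simp
  · intro f
    ext v
    have h2 := mem_Icc.1 ((mem_homs.1 (mem_coe.1 f.2)).1 v)
    change (((f.1 v - 1).toNat : ℕ) : ℤ) + 1 = f.1 v
    omega

/-- Restriction and gluing of homomorphisms along a bridge. -/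
lemma sum_homs_glue (S : Set V) {r c : V} (hr : r ∈ S) (hc : c ∉ S) (hrc : T.Adj r c)
    (hS : ∀ v ∈ S, ∀ w ∉ S, T.Adj v w → v = r ∧ w = c) (F : (S → ℤ) → ((Sᶜ : Set V) → ℤ) → ℝ) :
    ∑ h ∈ homs T N, F (fun v => h v) (fun v => h v) =
      ∑ f ∈ homs (T.induce S) N, ∑ g ∈ homs (T.induce Sᶜ) N,
        if |f ⟨r, hr⟩ - g ⟨c, hc⟩| = 1 then F f g else 0 := by
  classical
  rw [← sum_product', ← sum_filter]
  refine sum_bij' (fun h _ => (fun v => h v, fun v => h v))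
    (fun fg _ v => if hv : v ∈ S then fg.1 ⟨v, hv⟩ else fg.2 ⟨v, hv⟩) ?_ ?_ ?_ ?_ ?_
  · intro h hh
    rw [mem_homs] at hh
    rw [mem_filter, mem_product, mem_homs, mem_homs]
    exact ⟨⟨⟨fun v => hh.1 v, fun v w hvw => hh.2 v w hvw⟩,
      ⟨fun v => hh.1 v, fun v w hvw => hh.2 v w hvw⟩⟩, hh.2 r c hrc⟩
  · rintro ⟨f, g⟩ hfg
    rw [mem_filter, mem_product, mem_homs, mem_homs] at hfg
    obtain ⟨⟨⟨hf1, hf2⟩, hg1, hg2⟩, h1⟩ := hfg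
    rw [mem_homs]
    refine ⟨fun v => ?_, fun v w hvw => ?_⟩
    · by_cases hv : v ∈ S
      · simpa only [hv, dif_pos] using hf1 ⟨v, hv⟩
      · simpa only [hv, dif_neg, not_false_iff] using hg1 ⟨v, hv⟩
    · by_cases hv : v ∈ S <;> by_cases hw : w ∈ S
      · simpa only [hv, hw, dif_pos] using hf2 ⟨v, hv⟩ ⟨w, hw⟩ hvw
      · obtain ⟨rfl, rfl⟩ := hS v hv w hw hvw
        simpa only [hv, hw, dif_pos, dif_neg, not_false_iff] using h1
      · obtain ⟨rfl, rfl⟩ := hS w hw v hv hvw.symm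
        rw [abs_sub_comm]
        simpa only [hv, hw, dif_pos, dif_neg, not_false_iff] using h1
      · simpa only [hv, hw, dif_neg, not_false_iff] using hg2 ⟨v, hv⟩ ⟨w, hw⟩ hvw
  · intro h _
    funext v
    simp
  · rintro ⟨f, g⟩ _
    ext v
    · simp [v.2]
    · have : (v : V) ∉ S := v.2
      simp [this]
  · intro h _
    rfl

/-- The number of homomorphisms sending `r` to a given position. -/
noncomputable def rootVec (T : SimpleGraph V) (N : ℤ) (r : V) : ℤ → ℝ :=
  fun i => ∑ f ∈ homs T N, if f r = i then 1 else 0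

lemma pairing_rootVec (φ : ℤ → ℝ) (r : V) :
    pairing N φ (rootVec T N r) = ∑ f ∈ homs T N, φ (f r) := by
  simp only [pairing, rootVec, mul_sum]
  rw [sum_comm]
  refine sum_congr rfl fun f hf => ?_
  simp only [mul_ite, mul_one, mul_zero, sum_ite_eq, (mem_homs.1 hf).1 r, if_true]

lemma pathOp_eq_pairing (f : ℤ → ℝ) {i : ℤ} (hi : i ∈ Icc 1 N) :
    pathOp N f i = pairing N (fun j => if |i - j| = 1 then 1 else 0) f := by
  rw [pathOp_apply, if_pos hi, pairing]
  exact sum_congr rfl fun j _ => by simp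

lemma pathOp_rootVec (r : V) {i : ℤ} (hi : i ∈ Icc 1 N) :
    pathOp N (rootVec T N r) i = ∑ f ∈ homs T N, if |i - f r| = 1 then 1 else 0 := by
  rw [pathOp_eq_pairing _ hi, pairing_rootVec]

lemma sum_homs_fiber (r : V) (F : (V → ℤ) → ℝ) :
    ∑ f ∈ homs T N, F f = ∑ i ∈ Icc 1 N, ∑ f ∈ homs T N, if f r = i then F f else 0 := by
  rw [sum_comm]
  refine sum_congr rfl fun f hf => ?_
  rw [sum_ite_eq, if_pos ((mem_homs.1 hf).1 r)]

lemma card_homs_eq_pairing (r : V) :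
    ((homs T N).card : ℝ) = pairing N (one N) (rootVec T N r) := by
  rw [pairing_rootVec, card_eq_sum_ones, Nat.cast_sum]
  exact sum_congr rfl fun f hf => by simp [one, mem_Icc.1 ((mem_homs.1 hf).1 r)]

lemma rootVec_of_subsingleton [Subsingleton V] (r : V) : rootVec T N r = one N := by
  classical
  funext i
  have : ∀ f ∈ homs T N, (if f r = i then (1 : ℝ) else 0) = if f = fun _ => i then 1 else 0 := by
    intro f _
    congr 1
    rw [funext_iff]
    exact propext ⟨fun h v => by rw [Subsingleton.elim v r, h], fun h => h r⟩
  rw [rootVec, sum_congr rfl this, sum_ite_eq', one]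
  congr 1
  rw [mem_homs]
  exact propext ⟨fun h => h.1 r, fun h => ⟨fun _ => h, fun v w hvw =>
    absurd (Subsingleton.elim v w) hvw.ne⟩⟩

lemma rootVec_glue (S : Set V) {r c : V} (hr : r ∈ S) (hc : c ∉ S) (hrc : T.Adj r c)
    (hS : ∀ v ∈ S, ∀ w ∉ S, T.Adj v w → v = r ∧ w = c) :
    rootVec T N r = rootVec (T.induce S) N ⟨r, hr⟩ *
      pathOp N (rootVec (T.induce Sᶜ) N ⟨c, hc⟩) := by
  funext i
  rw [Pi.mul_apply, rootVec, sum_homs_glue S hr hc hrc hS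
    (fun f _ => if f ⟨r, hr⟩ = i then 1 else 0), rootVec, sum_mul]
  refine sum_congr rfl fun f hf => ?_
  split_ifs with h
  · rw [one_mul, pathOp_rootVec _ (h ▸ (mem_homs.1 hf).1 _), h]
  · simp

end

/-! ### Counts for paths and stars -/

/-- The number of homomorphisms from a path, with the first vertex weighted. -/
lemma sum_homs_pathGraph (N : ℤ) (k : ℕ) (φ : ℤ → ℝ) :
    ∑ f ∈ homs (SimpleGraph.pathGraph (k + 1)) N, φ (f 0) =
      pairing N φ ((pathOp N ^ k) (one N)) := by
  induction k generalizing φ with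
  | zero =>
    have : Subsingleton (Fin (0 + 1)) := inferInstanceAs (Subsingleton (Fin 1))
    rw [← pairing_rootVec, rootVec_of_subsingleton]; simp
  | succ k ih =>
    -- Removing the first vertex leaves a path whose first vertex has weight `pathOp N φ`.
    rw [pow_pathOp_succ, pairing_pathOp, ← ih]
    have h : ∀ g ∈ homs (SimpleGraph.pathGraph (k + 1)) N, pathOp N φ (g 0) =
        ∑ j ∈ Icc 1 N, if |g 0 - j| = 1 then φ j else 0 := fun g hg => by
      rw [pathOp_apply, if_pos ((mem_homs.1 hg).1 0)]
    rw [sum_congr rfl h, ← sum_product', ← sum_filter]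
    refine sum_bij' (fun f _ => (Fin.tail f, f 0)) (fun g _ => Fin.cons g.2 g.1) ?_ ?_ ?_ ?_ ?_
    · intro f hf
      rw [mem_homs] at hf
      rw [mem_filter, mem_product, mem_homs]
      refine ⟨⟨⟨fun v => hf.1 _, fun v w hvw => hf.2 _ _ ?_⟩, hf.1 0⟩, hf.2 _ _ ?_⟩
      · rw [SimpleGraph.pathGraph_adj] at hvw ⊢
        simpa using hvw
      · rw [SimpleGraph.pathGraph_adj]; simp
    · rintro ⟨g, j⟩ hg
      rw [mem_filter, mem_product, mem_homs] at hg
      obtain ⟨⟨⟨h1, h2⟩, h3⟩, h4⟩ := hg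
      rw [mem_homs]
      refine ⟨fun v => ?_, fun v w hvw => ?_⟩
      · cases v using Fin.cases with
        | zero => exact h3
        | succ v => exact h1 v
      · rw [SimpleGraph.pathGraph_adj] at hvw
        cases v using Fin.cases with
        | zero =>
          cases w using Fin.cases with
          | zero => simp at hvw
          | succ w =>
            have hw : w = 0 := by ext; simp at hvw; simp [hvw]
            subst hw
            rw [abs_sub_comm]; exact h4
        | succ v =>
          cases w using Fin.cases with
          | zero =>
            have hv : v = 0 := by ext; simp at hvw; simp [hvw]
            subst hv
            exact h4
          | succ w =>
            refine h2 v w ?_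
            rw [SimpleGraph.pathGraph_adj]
            simpa using hvw
    · intro f _
      exact Fin.cons_self_tail f
    · intro g _
      simp
    · intro f _
      rfl

lemma card_homs_pathGraph (N : ℤ) (k : ℕ) :
    ((homs (SimpleGraph.pathGraph (k + 1)) N).card : ℝ) =
      pairing N (one N) ((pathOp N ^ k) (one N)) := by
  rw [← sum_homs_pathGraph, card_eq_sum_ones, Nat.cast_sum]
  exact sum_congr rfl fun f hf => by simp [one, mem_Icc.1 ((mem_homs.1 hf).1 0)]

/-- Once the centre is at `i`, the leaves choose neighbours of `i` independently. -/
lemma card_homs_starGraph (N : ℤ) (k : ℕ) :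
    ((homs (SimpleGraph.starGraph (0 : Fin (k + 1))) N).card : ℝ) =
      ∑ i ∈ Icc 1 N, (pathOp N (one N) i) ^ k := by
  classical
  have h := sum_homs_fiber (T := SimpleGraph.starGraph (0 : Fin (k + 1))) (N := N) 0 (fun _ => 1)
  rw [card_eq_sum_ones, Nat.cast_sum]
  push_cast
  rw [h]
  refine sum_congr rfl fun i hi => ?_
  have h1 : (homs (SimpleGraph.starGraph (0 : Fin (k + 1))) N).filter (fun f => f 0 = i) =
      Fintype.piFinset (Fin.cons {i} (fun _ => (Icc 1 N).filter fun j => |i - j| = 1) :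
        Fin (k + 1) → Finset ℤ) := by
    ext f
    have hpi : f ∈ Fintype.piFinset (Fin.cons {i} (fun _ => (Icc 1 N).filter fun j => |i - j| = 1) :
        Fin (k + 1) → Finset ℤ) ↔
        f 0 = i ∧ ∀ v : Fin k, f v.succ ∈ Icc 1 N ∧ |i - f v.succ| = 1 := by
      rw [Fintype.mem_piFinset, Fin.forall_fin_succ]
      simp only [Fin.cons_zero, Fin.cons_succ, mem_singleton, mem_filter]
    rw [mem_filter, mem_homs, hpi]
    simp only [SimpleGraph.starGraph_adj]
    constructor
    · rintro ⟨⟨h1, h2⟩, rfl⟩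
      exact ⟨rfl, fun v => ⟨h1 _, h2 _ _ (by simp [Fin.succ_ne_zero, eq_comm])⟩⟩
    · rintro ⟨rfl, h2⟩
      refine ⟨⟨fun v => ?_, fun v w hvw => ?_⟩, rfl⟩
      · cases v using Fin.cases with
        | zero => exact hi
        | succ v => exact (h2 v).1
      · cases v using Fin.cases with
        | zero =>
          cases w using Fin.cases with
          | zero => simp at hvw
          | succ w => exact (h2 w).2
        | succ v =>
          cases w using Fin.cases with
          | zero => rw [abs_sub_comm]; exact (h2 v).2
          | succ w => simp [Fin.succ_ne_zero] at hvw
  rw [← sum_filter, h1, sum_const, Fintype.card_piFinset, Fin.prod_univ_succ]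
  simp only [Fin.cons_zero, Fin.cons_succ, card_singleton, prod_const, card_univ, Fintype.card_fin,
    one_mul, nsmul_eq_mul, mul_one, Nat.cast_pow]
  congr 1
  rw [pathOp_apply, if_pos hi, card_eq_sum_ones, sum_filter, Nat.cast_sum]
  exact sum_congr rfl fun j hj => by simp [one, mem_Icc.1 hj]

end PathHom

/-! ### Decomposing trees -/

namespace PathHom

open Finset SimpleGraph

variable {V : Type*} {T : SimpleGraph V}

/-- An edge of a tree splits it into two trees. -/
lemma exists_bridge_sides (hT : T.IsTree) {r c : V} (hrc : T.Adj r c) :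
    ∃ S : Set V, r ∈ S ∧ c ∉ S ∧ (∀ v ∈ S, ∀ w ∉ S, T.Adj v w → v = r ∧ w = c) ∧
      (T.induce S).IsTree ∧ (T.induce Sᶜ).IsTree := by
  set D := T.deleteEdges {s(r, c)} with hD
  have hle : D ≤ T := deleteEdges_le _
  have hbr : ¬ D.Reachable r c := isAcyclic_iff_forall_adj_isBridge.1 hT.isAcyclic hrc
  have hDadj : ∀ {v w}, T.Adj v w → s(v, w) ≠ s(r, c) → D.Adj v w := fun h h' => by
    rw [hD, deleteEdges_adj]; exact ⟨h, h'⟩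
  -- Without the edge `rc`, every vertex is still reachable from `r` or from `c`.
  have hcov : ∀ {a v} (_ : T.Walk a v), (D.Reachable r a ∨ D.Reachable c a) →
      (D.Reachable r v ∨ D.Reachable c v) := by
    intro a v p
    induction p with
    | nil => exact id
    | @cons a b v h p ih =>
      refine fun ha => ih ?_
      by_cases hab : s(a, b) = s(r, c)
      · rcases Sym2.eq_iff.1 hab with ⟨_, rfl⟩ | ⟨_, rfl⟩
        · exact Or.inr (Reachable.refl _)
        · exact Or.inl (Reachable.refl _)
      · exact ha.imp (fun h' => h'.trans (hDadj h hab).reachable)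
          (fun h' => h'.trans (hDadj h hab).reachable)
  have hSc : {v | D.Reachable r v}ᶜ = {v | D.Reachable c v} := by
    ext v
    simp only [Set.mem_compl_iff, Set.mem_ofPred_eq]
    refine ⟨fun h => ?_, fun h h' => hbr (h'.trans h.symm)⟩
    obtain ⟨p⟩ := hT.connected.preconnected r v
    exact (hcov p (Or.inl (Reachable.refl _))).resolve_left h
  have hconn : ∀ a, (T.induce {v | D.Reachable a v}).Connected := fun a => by
    have h1 := (D.connectedComponentMk a).connected_toSimpleGraph
    have h2 : (D.connectedComponentMk a).supp = {v | D.Reachable a v} := by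
      ext v
      simp only [ConnectedComponent.mem_supp_iff, ConnectedComponent.eq, Set.mem_ofPred_eq]
      exact reachable_comm
    have h3 : (D.induce (D.connectedComponentMk a).supp).Connected := h1
    rw [h2] at h3
    exact h3.mono fun v w h => hle h
  refine ⟨{v | D.Reachable r v}, Reachable.refl _, hbr, ?_,
    ⟨hconn r, hT.isAcyclic.induce _⟩, ⟨?_, hT.isAcyclic.induce _⟩⟩
  · intro v hv w hw hvw
    by_cases hab : s(v, w) = s(r, c)
    · rcases Sym2.eq_iff.1 hab with h | ⟨rfl, rfl⟩
      · exact h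
      · exact absurd hv hbr
    · exact absurd (Reachable.trans hv (hDadj hvw hab).reachable) hw
  · rw [hSc]; exact hconn c

lemma exists_map_isPath (S : Set V) {a b : S} (p : (T.induce S).Walk a b) (hp : p.IsPath) :
    ∃ q : T.Walk a b, q.IsPath ∧ q.length = p.length ∧ ∀ v ∈ q.support, v ∈ S := by
  refine ⟨p.map (Embedding.induce S).toHom,
    hp.map Subtype.val_injective, Walk.length_map _ _, fun v hv => ?_⟩
  obtain ⟨w, _, rfl⟩ := List.mem_map.1 ((Walk.support_map _ _).subst (motive := (v ∈ ·)) hv)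
  exact w.2

/-- The homomorphism counts of a rooted tree form a rooted vector, whose height is witnessed by a
path starting at the root. -/
theorem exists_rootedVector [Finite V] (hT : T.IsTree) (N : ℤ) (r : V) :
    ∃ p q t, p + q = Nat.card V ∧ RootedVector N p q t (rootVec T N r) ∧
      ∃ (v : V) (w : T.Walk r v), w.IsPath ∧ w.length = t := by
  induction hn : Nat.card V using Nat.strong_induction_on generalizing V with
  | _ n ih =>
    subst hn
    rcases subsingleton_or_nontrivial V with hV | hV
    · have : Unique V := ⟨⟨r⟩, fun v => Subsingleton.elim v r⟩
      refine ⟨1, 0, 0, by simp, ?_, r, Walk.nil, Walk.IsPath.nil, rfl⟩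
      rw [rootVec_of_subsingleton]
      exact RootedVector.single
    obtain ⟨c, hrc⟩ := hT.connected.preconnected.exists_adj_of_nontrivial r
    obtain ⟨S, hr, hc, hS, hT1, hT2⟩ := exists_bridge_sides hT hrc
    have hcard : Nat.card S + Nat.card (Sᶜ : Set V) = Nat.card V := by
      rw [Nat.card_coe_set_eq, Nat.card_coe_set_eq, Set.ncard_add_ncard_compl]
    have : Nonempty S := ⟨⟨r, hr⟩⟩
    have : Nonempty (Sᶜ : Set V) := ⟨⟨c, hc⟩⟩
    have hpos1 : 0 < Nat.card S := Nat.card_pos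
    have hpos2 : 0 < Nat.card (Sᶜ : Set V) := Nat.card_pos
    obtain ⟨p, q, t, h1, h2, v, w, h3, h4⟩ := ih (Nat.card S) (by omega) hT1 ⟨r, hr⟩ rfl
    obtain ⟨p', q', t', h1', h2', v', w', h3', h4'⟩ :=
      ih (Nat.card (Sᶜ : Set V)) (by omega) hT2 ⟨c, hc⟩ rfl
    refine ⟨p + q', q + p', max t (t' + 1), by omega, ?_, ?_⟩
    · rw [rootVec_glue S hr hc hrc hS]
      exact h2.glue h2'
    · rcases le_total t (t' + 1) with h | h
      · rw [max_eq_right h]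
        obtain ⟨w'', h5, h6, h7⟩ := exists_map_isPath Sᶜ w' h3'
        exact ⟨v', Walk.cons hrc w'', h5.cons fun hmem => h7 r hmem hr,
          by rw [Walk.length_cons, h6, h4']⟩
      · rw [max_eq_left h]
        obtain ⟨w'', h5, h6, _⟩ := exists_map_isPath S w h3
        exact ⟨v, w'', h5, by rw [h6, h4]⟩

lemma exists_induce_isPath (S : Set V) {a b : V} (p : T.Walk a b) (hp : p.IsPath)
    (hS : ∀ v ∈ p.support, v ∈ S) (ha : a ∈ S) (hb : b ∈ S) :
    ∃ q : (T.induce S).Walk ⟨a, ha⟩ ⟨b, hb⟩, q.IsPath ∧ q.length = p.length ∧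
      (∀ v ∈ q.support, (v : V) ∈ p.support) ∧
      ∀ v w : S, s((v : V), (w : V)) ∈ p.edges → s(v, w) ∈ q.edges := by
  have hmap := Walk.map_induce p hS
  have hsupport : (p.induce S hS).support.map Subtype.val = p.support :=
    (Walk.support_map _ _).symm.trans (congrArg Walk.support hmap)
  have hedges : (p.induce S hS).edges.map (Sym2.map Subtype.val) = p.edges :=
    (Walk.edges_map _ _).symm.trans (congrArg Walk.edges hmap)
  refine ⟨p.induce S hS, ?_, ?_, ?_, ?_⟩
  · rw [Walk.isPath_def, ← hsupport] at hp
    exact Walk.IsPath.mk' hp.of_map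
  · exact (Walk.length_map _ _).symm.trans (congrArg Walk.length hmap)
  · intro v hv
    rw [← hsupport]
    exact List.mem_map_of_mem hv
  · intro v w hvw
    rw [← hedges] at hvw
    obtain ⟨e, he, h⟩ := List.mem_map.1 hvw
    have : e = s(v, w) := Sym2.map.injective Subtype.val_injective (by rw [h]; rfl)
    rwa [← this]

/-- Homomorphism counts with a bare path hanging at `x`: all edges at vertices of the path other
than `x` are edges of the path. -/
theorem exists_rootedVector_of_bare_path [Finite V] (hT : T.IsTree) (N : ℤ) {x z : V}
    (p : T.Walk z x) (hp : p.IsPath)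
    (hbare : ∀ v ∈ p.support, v ≠ x → ∀ w, T.Adj v w → s(v, w) ∈ p.edges) :
    ∃ p' q t a, RootedVector N p' q t a ∧
      (∃ (v : V) (w : T.Walk z v), w.IsPath ∧ w.length = p.length + t) ∧
      ∀ (φ : ℤ → ℝ) (i : ℤ), ∑ f ∈ homs T N, (if f x = i then φ (f z) else 0) =
        a i * (pathOp N ^ p.length) φ i := by
  induction hk : p.length generalizing V with
  | zero =>
    obtain rfl := Walk.eq_of_length_eq_zero hk
    obtain ⟨p', q, t, _, h1, v, w, h2, h3⟩ := exists_rootedVector hT N z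
    refine ⟨p', q, t, _, h1, ⟨v, w, h2, by omega⟩, fun φ i => ?_⟩
    rw [rootVec, sum_mul]
    refine sum_congr rfl fun f _ => ?_
    split_ifs with h
    · simp [h]
    · simp
  | succ k ih =>
    cases p with
    | nil => simp at hk
    | @cons _ z' _ h p =>
      rw [Walk.cons_isPath_iff] at hp
      rw [Walk.length_cons, Nat.add_right_cancel_iff] at hk
      have hzx : z ≠ x := fun hzx => hp.2 (hzx ▸ p.end_mem_support)
      -- The start of the bare path is a leaf, and removing it turns the weight `φ` at `z` into
      -- `pathOp N φ` at `z'`.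
      have hz : ∀ w, T.Adj z w → w = z' := fun w hw => by
        have h1 := hbare z (Walk.start_mem_support _) hzx w hw
        rw [Walk.edges_cons, List.mem_cons] at h1
        rcases h1 with h1 | h1
        · exact Sym2.congr_right.1 h1
        · exact absurd (p.fst_mem_support_of_mem_edges h1) hp.2
      set S : Set V := {z}ᶜ with hS
      have hz'S : z' ∈ S := h.ne'
      have hxS : x ∈ S := hzx.symm
      have hzS : z ∉ S := fun h => h rfl
      have hcross : ∀ v ∈ S, ∀ w ∉ S, T.Adj v w → v = z' ∧ w = z := by
        intro v _ w hw hvw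
        obtain rfl : w = z := by simpa [hS] using hw
        exact ⟨hz v hvw.symm, rfl⟩
      have hT' : (T.induce S).IsTree := by
        classical
        refine ⟨?_, hT.isAcyclic.induce _⟩
        have := Fintype.ofFinite (T.neighborSet z)
        exact hT.connected.induce_compl_singleton_of_degree_eq_one
          (degree_eq_one_iff_existsUnique_adj.2 ⟨z', h, hz⟩)
      have hpS : ∀ v ∈ p.support, v ∈ S := fun v hv hvz => hp.2 (hvz ▸ hv)
      obtain ⟨w, hw1, hw2, hw3, hw4⟩ := exists_induce_isPath S p hp.1 hpS hz'S hxS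
      have hbare' : ∀ v ∈ w.support, v ≠ ⟨x, hxS⟩ → ∀ u, (T.induce S).Adj v u →
          s(v, u) ∈ w.edges := by
        intro v hv hvx u hvu
        refine hw4 v u ?_
        have h1 := hbare v (List.mem_cons_of_mem _ (hw3 v hv))
          (fun h => hvx (Subtype.ext h)) u hvu
        rw [Walk.edges_cons, List.mem_cons] at h1
        refine h1.resolve_left fun h2 => ?_
        rcases Sym2.eq_iff.1 h2 with ⟨h3, _⟩ | ⟨_, h3⟩
        · exact v.2 h3
        · exact u.2 h3
      obtain ⟨p', q, t, a, h1, ⟨v, w', h2, h3⟩, h4⟩ :=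
        ih hT' w hw1 hbare' (hw2.trans hk)
      refine ⟨p', q, t, a, h1, ?_, fun φ i => ?_⟩
      · obtain ⟨w'', h5, h6, h7⟩ := exists_map_isPath S w' h2
        exact ⟨v, Walk.cons h w'', h5.cons fun hmem => hzS (h7 z hmem),
          by rw [Walk.length_cons, h6, h3]; omega⟩
      · rw [pow_pathOp_succ', ← h4, sum_homs_glue S hz'S hzS h.symm hcross
          (fun f g => if f ⟨x, hxS⟩ = i then φ (g ⟨z, hzS⟩) else 0)]
        refine sum_congr rfl fun f hf => ?_
        split_ifs with hfx
        · have : Subsingleton (Sᶜ : Set V) := by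
            rw [hS, compl_compl]; infer_instance
          have hfz := (mem_homs.1 hf).1 ⟨z', hz'S⟩
          rw [pathOp_apply, if_pos hfz, ← pairing_rootVec
            (fun j => if |f ⟨z', hz'S⟩ - j| = 1 then φ j else 0), rootVec_of_subsingleton,
            pairing_one]
        · simp

/-! ### The KC-transformation -/

lemma moveNeighbors_adj {x y z u v : V} : (T.moveNeighbors x y z).Adj u v ↔
    (T.Adj u v ∧ ∀ w, T.Adj y w → w ≠ z → s(u, v) ≠ s(y, w)) ∨
      ((∃ w, T.Adj y w ∧ w ≠ z ∧ s(u, v) = s(x, w)) ∧ u ≠ v) := by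
  simp only [moveNeighbors, sup_adj, deleteEdges_adj, fromEdgeSet_adj, Set.mem_ofPred_eq,
    Set.mem_sdiff, mem_neighborSet, Set.mem_singleton_iff, not_exists, not_and, and_assoc,
    ne_eq]

/-- The only exit from `S` is through `c`. -/
lemma walk_support_subset (S : Set V) {r c : V}
    (hS : ∀ v ∈ S, ∀ w ∉ S, T.Adj v w → v = r ∧ w = c) {a b : V} (p : T.Walk a b) (ha : a ∈ S)
    (hc : c ∉ p.support) : ∀ v ∈ p.support, v ∈ S := by
  induction p with
  | nil => simpa using ha
  | @cons a a' b h p ih =>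
    rw [Walk.support_cons, List.mem_cons, not_or] at hc
    intro v hv
    rw [Walk.support_cons, List.mem_cons] at hv
    rcases hv with rfl | hv
    · exact ha
    · refine ih ?_ hc.2 v hv
      by_contra ha'
      exact hc.2 ((hS a ha a' ha' h).2 ▸ p.start_mem_support)

/-- The homomorphisms from the graph obtained by moving the neighbors of `y` to `x`, where `y` is
separated from `x` and its neighbor `z` by the edge `zy`. -/
lemma card_homs_moveNeighbors [Finite V] (N : ℤ) (S : Set V) {x y z : V} (hx : x ∈ S)
    (hz : z ∈ S) (hy : y ∉ S) (hzy : T.Adj z y)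
    (hS : ∀ v ∈ S, ∀ w ∉ S, T.Adj v w → v = z ∧ w = y) :
    ((homs (T.moveNeighbors x y z) N).card : ℝ) = ∑ f ∈ homs (T.induce S) N,
      pathOp N (one N) (f ⟨z, hz⟩) * rootVec (T.induce Sᶜ) N ⟨y, hy⟩ (f ⟨x, hx⟩) := by
  classical
  have hrhs : ∀ f ∈ homs (T.induce S) N,
      pathOp N (one N) (f ⟨z, hz⟩) * rootVec (T.induce Sᶜ) N ⟨y, hy⟩ (f ⟨x, hx⟩) =
      ∑ jg ∈ Icc 1 N ×ˢ homs (T.induce Sᶜ) N,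
        if |f ⟨z, hz⟩ - jg.1| = 1 ∧ jg.2 ⟨y, hy⟩ = f ⟨x, hx⟩ then (1 : ℝ) else 0 := by
    intro f hf
    rw [pathOp_apply, if_pos ((mem_homs.1 hf).1 _), rootVec, sum_mul_sum, sum_product]
    refine sum_congr rfl fun j hj => sum_congr rfl fun g _ => ?_
    simp only [one, hj, if_true]
    split_ifs <;> simp_all
  rw [sum_congr rfl hrhs, ← sum_product', ← sum_filter, card_eq_sum_ones, Nat.cast_sum]
  have hxy : x ≠ y := fun h => hy (h ▸ hx)
  have hzyne : z ≠ y := fun h => hy (h ▸ hz)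
  have hyN : ∀ w, T.Adj y w → w ≠ z → w ∉ S := fun w hw hwz hwS =>
    hwz (hS w hwS y hy hw.symm).1
  -- In the new graph `y` is a leaf at `z`, and `x` plays the former role of `y` for the vertices
  -- outside `S`. Hence the value at `y` is split off and replaced by the value at `x`.
  refine sum_bij' (fun h _ => (fun v => h v, h y, fun v => if (v : V) = y then h x else h v))
    (fun fg _ v => if hv : v ∈ S then fg.1 ⟨v, hv⟩ else if v = y then fg.2.1 else fg.2.2 ⟨v, hv⟩)
    ?_ ?_ ?_ ?_ ?_
  · intro h hh
    rw [mem_homs] at hh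
    obtain ⟨h1, h2⟩ := hh
    simp only [mem_filter, mem_product, mem_homs, if_true, and_true]
    refine ⟨⟨⟨fun v => h1 v, fun v w hvw => h2 v w ?_⟩, h1 y, fun v => ?_, fun v w hvw => ?_⟩,
      h2 z y ?_⟩
    · rw [moveNeighbors_adj]
      refine Or.inl ⟨hvw, fun u _ _ h3 => ?_⟩
      rcases Sym2.eq_iff.1 h3 with ⟨h4, _⟩ | ⟨_, h4⟩
      · exact hy (h4 ▸ v.2)
      · exact hy (h4 ▸ w.2)
    · split_ifs
      · exact h1 x
      · exact h1 v
    · have hvw' : T.Adj v w := hvw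
      have key : ∀ w : V, T.Adj y w → w ∉ S → |h x - h w| = 1 := fun w hw hwS => by
        refine h2 x w ?_
        rw [moveNeighbors_adj]
        exact Or.inr ⟨⟨w, hw, fun hwz => hwS (hwz ▸ hz), rfl⟩, fun hxw => hwS (hxw ▸ hx)⟩
      by_cases hv : (v : V) = y <;> by_cases hw : (w : V) = y
      · exact absurd (hv.trans hw.symm) hvw'.ne
      · simp only [hv, hw, if_true, if_false]
        exact key w (hv ▸ hvw') w.2
      · simp only [hv, hw, if_true, if_false]
        rw [abs_sub_comm]
        exact key v (hw ▸ hvw'.symm) v.2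
      · simp only [hv, hw, if_false]
        refine h2 v w ?_
        rw [moveNeighbors_adj]
        refine Or.inl ⟨hvw', fun u _ _ h3 => ?_⟩
        rcases Sym2.eq_iff.1 h3 with ⟨h4, _⟩ | ⟨_, h4⟩
        · exact hv h4
        · exact hw h4
    · rw [moveNeighbors_adj]
      refine Or.inl ⟨hzy, fun u _ hu h3 => ?_⟩
      rcases Sym2.eq_iff.1 h3 with ⟨h4, _⟩ | ⟨h4, _⟩
      · exact hzyne h4
      · exact hu h4.symm
  · rintro ⟨f, j, g⟩ hfg
    simp only [mem_filter, mem_product, mem_homs] at hfg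
    obtain ⟨⟨⟨hf1, hf2⟩, hj, hg1, hg2⟩, h1, h3⟩ := hfg
    rw [mem_homs]
    refine ⟨fun v => ?_, ?_⟩
    · split_ifs with hv hvy
      · exact hf1 _
      · exact hj
      · exact hg1 _
    have hmoved : ∀ w, T.Adj y w → w ≠ z → ∃ hw : w ∉ S, w ≠ y ∧ |f ⟨x, hx⟩ - g ⟨w, hw⟩| = 1 :=
      fun w hw hwz => ⟨hyN w hw hwz, hw.ne', by
        rw [← h3]; exact hg2 ⟨y, hy⟩ ⟨w, hyN w hw hwz⟩ hw⟩
    intro v w hvw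
    rw [moveNeighbors_adj] at hvw
    rcases hvw with ⟨hvw, h4⟩ | ⟨⟨u, hu, huz, h4⟩, hne⟩
    · by_cases hv : v ∈ S <;> by_cases hw : w ∈ S
      · simpa only [hv, hw, dif_pos] using hf2 ⟨v, hv⟩ ⟨w, hw⟩ hvw
      · obtain ⟨rfl, rfl⟩ := hS v hv w hw hvw
        simpa only [hv, hw, dif_pos, dif_neg, not_false_iff, if_true] using h1
      · obtain ⟨rfl, rfl⟩ := hS w hw v hv hvw.symm
        rw [abs_sub_comm]
        simpa only [hv, hw, dif_pos, dif_neg, not_false_iff, if_true] using h1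
      · have hvy : v ≠ y := by
          rintro rfl
          exact h4 w hvw (fun hwz => hw (hwz ▸ hz)) rfl
        have hwy : w ≠ y := by
          rintro rfl
          exact h4 v hvw.symm (fun hvz => hv (hvz ▸ hz)) Sym2.eq_swap
        simpa only [hv, hw, hvy, hwy, dif_neg, not_false_iff, if_false] using
          hg2 ⟨v, hv⟩ ⟨w, hw⟩ hvw
    · obtain ⟨huS, huy, h5⟩ := hmoved u hu huz
      rcases Sym2.eq_iff.1 h4 with ⟨rfl, rfl⟩ | ⟨rfl, rfl⟩
      · simpa only [hx, huS, huy, dif_pos, dif_neg, not_false_iff, if_false] using h5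
      · rw [abs_sub_comm]
        simpa only [hx, huS, huy, dif_pos, dif_neg, not_false_iff, if_false] using h5
  · intro h _
    funext v
    by_cases hv : v ∈ S
    · simp [hv]
    · by_cases hvy : v = y
      · simp [hvy, hy]
      · simp [hv, hvy]
  · rintro ⟨f, j, g⟩ hfg
    simp only [mem_filter, mem_product, mem_homs] at hfg
    obtain ⟨_, _, h3⟩ := hfg
    refine Prod.ext ?_ (Prod.ext ?_ ?_)
    · funext v
      simp [v.2]
    · simp [hy]
    · funext v
      have hv : (v : V) ∉ S := v.2
      by_cases hvy : (v : V) = y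
      · have : v = ⟨y, hy⟩ := Subtype.ext hvy
        subst this
        simp [hx, h3]
      · simp [hv, hvy]
  · intro h _
    simp

/-- The path already uses two edges at an interior vertex, which exhausts the degree. -/
lemma mem_edges_of_ncard_neighborSet_eq_two [Finite V] {y x : V} (W : T.Walk y x) (hW : W.IsPath)
    {v : V} (hv : v ∈ W.support) (hvy : v ≠ y) (hvx : v ≠ x) (hdeg : (T.neighborSet v).ncard = 2)
    {w : V} (hvw : T.Adj v w) : s(v, w) ∈ W.edges := by
  obtain ⟨i, rfl, hi⟩ := Walk.mem_support_iff_exists_getVert.1 hv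
  have h0 : i ≠ 0 := by rintro rfl; simp at hvy
  have h1 : i ≠ W.length := by rintro rfl; simp at hvx
  have h2 := hW.ncard_neighborSet_toSubgraph_internal_eq_two h0 (lt_of_le_of_ne hi h1)
  have h3 := Set.eq_of_subset_of_ncard_le (W.toSubgraph.neighborSet_subset (W.getVert i))
    (by rw [h2, hdeg]) (Set.toFinite _)
  have h4 : w ∈ W.toSubgraph.neighborSet (W.getVert i) := by rw [h3]; exact hvw
  exact Walk.adj_toSubgraph_iff_mem_edges.1 h4

/-- Paths in a tree are unique, hence geodesic. -/
lemma length_le_diam [Finite V] (hT : T.IsTree) {v w : V} (p : T.Walk v w) (hp : p.IsPath) :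
    p.length ≤ T.diam := by
  have : Nonempty V := ⟨v⟩
  obtain ⟨q, hq1, hq2⟩ := hT.connected.exists_path_of_dist v w
  have h : p = q := (hT.existsUnique_path v w).unique hp hq1
  rw [h, hq2]
  exact dist_le_diam (connected_iff_ediam_ne_top.1 hT.connected)

lemma isPath_append {a b c : V} {p : T.Walk a b} {q : T.Walk b c} (hp : p.IsPath) (hq : q.IsPath)
    (h : ∀ v ∈ p.support, v ∉ q.support.tail) : (p.append q).IsPath := by
  rw [Walk.isPath_def, Walk.support_append]
  refine List.Nodup.append hp.support_nodup (hq.support_nodup.sublist (List.tail_sublist _)) ?_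
  exact fun v h1 h2 => h v h1 h2

/-- Moving the neighbors of `y` to the other end `x` of a bare path does not decrease the number of
homomorphisms. -/
theorem card_homs_le_moveNeighbors [Finite V] (hT : T.IsTree) (n : ℕ) {x y z : V}
    (hyz : T.Adj y z) (p : T.Walk z x) (hp : (Walk.cons hyz p).IsPath)
    (hdeg : ∀ v ∈ p.support, v ≠ x → (T.neighborSet v).ncard = 2)
    (hn : Even n ∨ (Odd n ∧ T.diam ≤ n - 1)) :
    (homs T n).card ≤ (homs (T.moveNeighbors x y z) n).card := by
  have hp' := (Walk.cons_isPath_iff _ _).1 hp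
  obtain ⟨S, hz, hy, hS, hT1, hT2⟩ := exists_bridge_sides hT hyz.symm
  have hpS := walk_support_subset S hS p hz hp'.2
  have hx : x ∈ S := hpS x p.end_mem_support
  obtain ⟨w, hw1, hw2, hw3, hw4⟩ := exists_induce_isPath S p hp'.1 hpS hz hx
  have hbare : ∀ v ∈ w.support, v ≠ ⟨x, hx⟩ → ∀ u, (T.induce S).Adj v u → s(v, u) ∈ w.edges := by
    intro v hv hvx u hvu
    refine hw4 v u ?_
    have hvx' : (v : V) ≠ x := fun h => hvx (Subtype.ext h)
    have h1 := mem_edges_of_ncard_neighborSet_eq_two _ hp (List.mem_cons_of_mem _ (hw3 v hv))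
      (fun h => hy (h ▸ v.2)) hvx' (hdeg v (hw3 v hv) hvx') hvu
    rw [Walk.edges_cons, List.mem_cons] at h1
    refine h1.resolve_left fun h2 => ?_
    rcases Sym2.eq_iff.1 h2 with ⟨h3, _⟩ | ⟨_, h3⟩
    · exact hy (h3 ▸ v.2)
    · exact hy (h3 ▸ u.2)
  obtain ⟨p₁, q₁, t, a, ha, ⟨v₁, w₁, hw₁, hl₁⟩, hsum⟩ :=
    exists_rootedVector_of_bare_path hT1 n w hw1 hbare
  obtain ⟨p₂, q₂, s, _, hb, v₂, w₂, hw₂, hl₂⟩ := exists_rootedVector hT2 n ⟨y, hy⟩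
  set b := rootVec (T.induce Sᶜ) n ⟨y, hy⟩
  set k := w.length
  have hcount : ∀ φ ψ : ℤ → ℝ, ∑ f ∈ homs (T.induce S) n, ψ (f ⟨x, hx⟩) * φ (f ⟨z, hz⟩) =
      pairing n (a * ψ) ((pathOp n ^ k) φ) := by
    intro φ ψ
    rw [sum_homs_fiber ⟨x, hx⟩]
    refine sum_congr rfl fun i _ => ?_
    rw [Pi.mul_apply, mul_right_comm, ← hsum, sum_mul]
    refine sum_congr rfl fun f _ => ?_
    split_ifs with h
    · rw [h, mul_comm]
    · rw [zero_mul]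
  have h1 : ((homs T n).card : ℝ) = pairing n a ((pathOp n ^ (k + 1)) b) := by
    rw [card_eq_sum_ones, Nat.cast_sum, pow_pathOp_succ']
    have := hcount (pathOp n b) 1
    rw [mul_one] at this
    rw [← this]
    have h2 := sum_homs_glue (N := n) S hz hy hyz.symm hS (fun _ _ => 1)
    rw [show ((1 : ℕ) : ℝ) = 1 from Nat.cast_one, h2]
    refine sum_congr rfl fun f hf => ?_
    rw [pathOp_rootVec _ ((mem_homs.1 hf).1 _), Pi.one_apply, one_mul]
  have h2 : ((homs (T.moveNeighbors x y z) n).card : ℝ) =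
      pairing n (a * b) ((pathOp n ^ (k + 1)) (one n)) := by
    rw [card_homs_moveNeighbors n S hx hz hy hyz.symm hS, pow_pathOp_succ', ← hcount]
    exact sum_congr rfl fun f _ => mul_comm _ _
  have h3 : pairing n a ((pathOp n ^ (k + 1)) b) ≤
      pairing n (a * b) ((pathOp n ^ (k + 1)) (one n)) := by
    rcases hn with hn | ⟨hodd, hn⟩
    · exact ha.cone.pairing_pow_pathOp_le hb.cone _ (Or.inr (by exact_mod_cast hn.two_dvd))
    · refine ha.pairing_pow_pathOp_le hb _ ?_
      -- Longest branches at the two ends, joined through the bare path, form a path of length `s +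
      -- 1 + k + t`; the diameter bound on it is the room needed for translations.
      obtain ⟨u₁, hu₁, hlen₁, hmem₁⟩ := exists_map_isPath S w₁ hw₁
      obtain ⟨u₂, hu₂, hlen₂, hmem₂⟩ := exists_map_isPath Sᶜ w₂ hw₂
      have hpath : (u₂.reverse.append (Walk.cons hyz u₁)).IsPath := by
        refine isPath_append hu₂.reverse (hu₁.cons fun h => hy (hmem₁ y h)) fun v hv hv' => ?_
        rw [Walk.support_reverse, List.mem_reverse] at hv
        exact hmem₂ v hv (hmem₁ v hv')
      have hdiam := length_le_diam hT _ hpath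
      rw [Walk.length_append, Walk.length_reverse, Walk.length_cons, hlen₁, hlen₂, hl₁, hl₂]
        at hdiam
      have := hodd.pos
      push_cast
      omega
  rw [← h1, ← h2] at h3
  exact_mod_cast h3

/-! ### Comparison with the star and conclusion -/

lemma pairing_le_sum_pow {N : ℤ} {p q t : ℕ} {u : ℤ → ℝ} (hN : 0 ≤ N)
    (h : RootedVector N p q t u) (k : ℕ) (hk : p + q = k + 1) :
    pairing N (one N) u ≤ ∑ i ∈ Icc 1 N, (pathOp N (one N) i) ^ k := by
  have hpos : ∀ i, 0 ≤ pathOp N (one N) i := (Cone.one N).pathOp.nonneg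
  by_cases hN2 : 2 ≤ N
  · have h1 := h.pairing_le hN2 (one N) fun i hi => by simp [one, mem_Icc.1 hi]
    -- The left side is `2 ^ k` inside and `1` at the two ends; its sum is the bound of
    -- `RootedVector.pairing_le` with weight `1`.
    have h2 : ∀ i ∈ Icc 1 N, (2 : ℝ) ^ k - (2 ^ k - 1) * (if i = 1 then 1 else 0) -
        (2 ^ k - 1) * (if i = N then 1 else 0) ≤ (pathOp N (one N) i) ^ k := by
      intro i hi
      rw [pathOp_one_apply hi]
      split_ifs
      · omega
      · norm_num
      · norm_num
      · norm_num
    have h3 := sum_le_sum h2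
    rw [sum_sub_distrib, sum_sub_distrib, ← mul_sum, ← mul_sum, sum_ite_eq', sum_ite_eq',
      if_pos (by simp; omega), if_pos (by simp; omega), sum_const] at h3
    rw [pairing_one] at h1
    have h4 : ∑ i ∈ Icc 1 N, one N i = ((Icc 1 N).card : ℝ) := by
      rw [card_eq_sum_ones, Nat.cast_sum]
      exact sum_congr rfl fun i hi => by simp [one, mem_Icc.1 hi]
    rw [h4, hk, pow_succ] at h1
    rw [nsmul_eq_mul] at h3
    linarith
  · cases h with
    | single =>
      obtain rfl : k = 0 := by omega
      rw [pairing_one]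
      exact sum_le_sum fun i hi => by simp [one, mem_Icc.1 hi]
    -- For `N ≤ 1` the target has no edges, so a tree with an edge has no homomorphisms.
    | glue h1 h2 =>
      refine sum_le_sum fun i hi => ?_
      have hi' := mem_Icc.1 hi
      rw [Pi.mul_apply, pathOp_of_mem h2.cone.supported hi,
        h2.cone.supported (i - 1) (by rw [mem_Icc]; omega),
        h2.cone.supported (i + 1) (by rw [mem_Icc]; omega), add_zero, mul_zero, mul_zero]
      exact pow_nonneg (hpos i) k

end PathHom

theorem mainTheorem2 {V : Type*} [Finite V] (m n : ℕ) [NeZero m]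
    (T : SimpleGraph V) (hT : T.IsTree) (hm : Nat.card V = m) :
    (∀ T' : SimpleGraph V, T.IsKCTransformation T' →
      (Even n ∨ (Odd n ∧ T.diam ≤ n - 1)) →
        T.homCount (SimpleGraph.pathGraph n) ≤ T'.homCount (SimpleGraph.pathGraph n)) ∧
    ((SimpleGraph.pathGraph m).homCount (SimpleGraph.pathGraph n) ≤
        T.homCount (SimpleGraph.pathGraph n) ∧
      T.homCount (SimpleGraph.pathGraph n) ≤
        (SimpleGraph.starGraph (0 : Fin m)).homCount (SimpleGraph.pathGraph n)) := by
  constructor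
  · rintro T' ⟨x, y, p, hxy, hp, hdeg, rfl⟩ hn
    -- Reversal makes `z` the second vertex, so that the edge `yz` can be split off by cases.
    rw [PathHom.homCount_pathGraph, PathHom.homCount_pathGraph, ← SimpleGraph.Walk.snd_reverse]
    have hp' := hp.reverse
    have hsupp : ∀ v, v ∈ p.reverse.support → v ∈ p.support := fun v hv => by
      rwa [SimpleGraph.Walk.support_reverse, List.mem_reverse] at hv
    generalize p.reverse = r at hp' hsupp
    cases r with
    | nil => exact absurd rfl hxy
    | @cons _ z _ h r =>
      rw [SimpleGraph.Walk.snd_cons]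
      refine PathHom.card_homs_le_moveNeighbors hT n h r hp' (fun v hv hvx => ?_) hn
      refine hdeg v (hsupp v (List.mem_cons_of_mem _ hv)) hvx ?_
      rintro rfl
      exact ((SimpleGraph.Walk.cons_isPath_iff _ _).1 hp').2 hv
  · obtain ⟨r⟩ := hT.connected.nonempty
    obtain ⟨p, q, t, hpq, hu, -⟩ := PathHom.exists_rootedVector hT n r
    obtain ⟨k, rfl⟩ : ∃ k, m = k + 1 := ⟨m - 1, by have := NeZero.pos m; omega⟩
    rw [PathHom.homCount_pathGraph, PathHom.homCount_pathGraph, PathHom.homCount_pathGraph]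
    have hT' := PathHom.card_homs_eq_pairing (T := T) (N := n) r
    constructor
    · have h := hu.le_pairing_one k (hpq.trans hm)
      rw [← hT', ← PathHom.card_homs_pathGraph] at h
      exact_mod_cast h
    · have h := PathHom.pairing_le_sum_pow (Int.natCast_nonneg n) hu k (hpq.trans hm)
      rw [← hT', ← PathHom.card_homs_starGraph] at h
      exact_mod_cast h
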